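/- Call $f:\mathbb N_{\ge 0}\to\mathbb R$ a Floyd function if $f(n)>0$ for all $n\ge 1$, $\sum_{n\ge 1} f(n)<\infty$, there is $\lambda>0$ such that $f(n)\ge f(n+1)\ge\lambda f(n)$ for all $n\ge 1$, and $f(0)=f(1)$. Let $G$ be a group with a finite generating set $S$, let $\Gamma_{G,S}$ be its Cayley graph and $d$ the word metric. Give an edge of $\Gamma_{G,S}$ joining $g$ and $h$ the length $f(d(1,\{g,h\}))$, and let $d_f$ be the induced path metric (the infimum of the lengths of edge paths). The Floyd boundary $\partial_f(G,S)$ is the complement of $\Gamma_{G,S}$ in the Cauchy completion of $(\Gamma_{G,S},d_f)$, with the subspace topology. **Theorem.** Let $A$, $B$, $C$ be infinite groups with finite generating sets $S_A$, $S_B$, $S_C$, and let $f$ be a Floyd function. Suppose that $\partial_f(A,S_A)$ is homeomorphic to $\partial_f(C,S_C)$. Then $\partial_f(A*B*C,\;S_A\cup S_B\cup S_C)$ is homeomorphic to $\partial_f(A*B,\;S_A\cup S_B)$. If moreover there is a constant $D$ with $f(n)\le D f(2n)$ for all $n\ge 1$, then $\partial_f(A*B*C,S)$ is homeomorphic to $\partial_f(A*B,S')$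 for all finite generating sets $S$ of $A*B*C$ and $S'$ of $A*B$. -/

import Mathlib

open scoped ENNReal Monoid.Coprod

namespace Floyd

/-- A Floyd function: a positive summable scaling function `f` on the positive integers with
`f n ≥ f (n + 1) ≥ c * f n` for some constant `c > 0`, extended to `0` by `f 0 = f 1`. -/
structure IsFloydFunction (f : ℕ → ℝ) : Prop where
  pos : ∀ n, 1 ≤ n → 0 < f n
  summable : Summable f
  decay : ∃ c : ℝ, 0 < c ∧ ∀ n, 1 ≤ n → f (n + 1) ≤ f n ∧ c * f n ≤ f (n + 1)
  zero : f 0 = f 1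

section

variable {G : Type*} [Group G]

/-- The word length of `g`: its distance to `1` in the Cayley graph of `G` with respect to `S`,
in which `g` is joined to `g * s` for every `s ∈ S`. -/
noncomputable def wordLength (S : Set G) (g : G) : ℕ :=
  (SimpleGraph.mulCayley S).dist 1 g

/-- The Floyd length of an edge path in the Cayley graph: an edge joining `g` and `h`
has length `f (d(1, {g, h}))`. -/
noncomputable def floydLength (f : ℕ → ℝ) (S : Set G) {v w : G}
    (p : (SimpleGraph.mulCayley S).Walk v w) : ℝ :=
  (p.darts.map fun e => f (min (wordLength S e.fst) (wordLength S e.snd))).sum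

/-- The Floyd distance: the infimum of the Floyd lengths of the edge paths from `v` to `w`.
It takes values in `[0, ∞]`, and it is finite when `S` generates `G`. -/
noncomputable def floydEDist (f : ℕ → ℝ) (S : Set G) (v w : G) : ℝ≥0∞ :=
  ⨅ p : (SimpleGraph.mulCayley S).Walk v w, ENNReal.ofReal (floydLength f S p)

theorem floydLength_append (f : ℕ → ℝ) (S : Set G) {u v w : G}
    (p : (SimpleGraph.mulCayley S).Walk u v) (q : (SimpleGraph.mulCayley S).Walk v w) :
    floydLength f S (p.append q) = floydLength f S p + floydLength f S q := by
  simp [floydLength, SimpleGraph.Walk.darts_append]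

theorem floydLength_reverse (f : ℕ → ℝ) (S : Set G) {u v : G}
    (p : (SimpleGraph.mulCayley S).Walk u v) :
    floydLength f S p.reverse = floydLength f S p := by
  simp [floydLength, SimpleGraph.Walk.darts_reverse, List.sum_reverse, Function.comp_def,
    min_comm]

theorem floydEDist_self (f : ℕ → ℝ) (S : Set G) (v : G) : floydEDist f S v v = 0 :=
  le_antisymm (iInf_le_of_le SimpleGraph.Walk.nil (by simp [floydLength])) bot_le

theorem floydEDist_comm (f : ℕ → ℝ) (S : Set G) (v w : G) :
    floydEDist f S v w = floydEDist f S w v := by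
  have key : ∀ v w : G, floydEDist f S v w ≤ floydEDist f S w v := fun v w =>
    le_iInf fun p => iInf_le_of_le p.reverse (by rw [floydLength_reverse])
  exact le_antisymm (key v w) (key w v)

theorem floydEDist_triangle (f : ℕ → ℝ) (S : Set G) (u v w : G) :
    floydEDist f S u w ≤ floydEDist f S u v + floydEDist f S v w := by
  refine ENNReal.le_iInf_add_iInf fun p q => iInf_le_of_le (p.append q) ?_
  rw [floydLength_append]
  exact ENNReal.ofReal_add_le

/-- The vertex set `G` of the Cayley graph with respect to `S`, equipped with the Floyd distance
attached to `f`. (For a Floyd function `f` and a generating set `S` this is a metric: any path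
leaving `v` has Floyd length at least `f (wordLength S v)`.) -/
def FloydGraph (_f : ℕ → ℝ) (_S : Set G) : Type _ := G

noncomputable instance (f : ℕ → ℝ) (S : Set G) : PseudoEMetricSpace (FloydGraph f S) where
  edist v w := floydEDist f S v w
  edist_self := floydEDist_self f S
  edist_comm := floydEDist_comm f S
  edist_triangle := floydEDist_triangle f S

/-- The Floyd completion: the Cauchy completion of the Cayley graph for the Floyd distance. -/
abbrev FloydCompletion (f : ℕ → ℝ) (S : Set G) : Type _ :=
  UniformSpace.Completion (FloydGraph f S)

/-- The Floyd boundary `∂_f(G)` computed with the generating set `S`: the points of the Floyd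
completion that do not lie in the Cayley graph, with the subspace topology. (Adding the interior
points of the edges to the graph would add to the completion only these points themselves.) -/
abbrev FloydBoundary (f : ℕ → ℝ) (S : Set G) : Type _ :=
  {x : FloydCompletion f S // x ∉ Set.range ((↑) : FloydGraph f S → FloydCompletion f S)}

end

/-- The subset of the free product `M ∗ N` given by `S ⊆ M` and `T ⊆ N`; it generates `M ∗ N`
if `S` generates `M` and `T` generates `N`. -/
def unionGens {M N : Type*} [Group M] [Group N] (S : Set M) (T : Set N) : Set (M ∗ N) :=
  Monoid.Coprod.inl '' S ∪ Monoid.Coprod.inr '' T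

end Floyd

/-! ### Matching isolated points of compactifications. -/

namespace Floyd

open Topology Filter Set

/-! For the union of generating sets, the Cayley graph of a free product is a tree-like union of the
cosets `w * H i`. A path entering such a coset must pass through one particular vertex, the gate of
its starting point. Gate maps are Lipschitz for Floyd distances, so they extend to the completions.
A boundary point is determined by its gates, and each gate is a vertex of the factor or a boundary
point of it. So the boundary is a tree-like union of copies of the boundaries of the factors, in
which the copies over each factor accumulate everywhere. The estimates behind this are
`floydEDist_le_tailSum` (a geodesic continued beyond `x` costs at most a tail of the series),
`floydEDist_le_of_gates`, `pieceMap_gateMap` and `exists_piece_near`.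

Such a space depends only on which homeomorphism types of pieces occur, not on the number of factors
carrying each type. Colouring `A` and `C` alike and `B` differently, the two free products show the
same two colours, and `GateSystem.nonempty_homeomorph` applies.

That uniqueness is a back-and-forth argument. A clopen good set containing a piece consists of that
piece and of clopen fibres over isolated points, and the fibres are again good. `exists_matching`
pairs the fibres in two good sets compatibly with a homeomorphism of the pieces, which yields a
closed relation that is still undecided on pairs of fibres. Refining it along all pieces on both
sides gives a decreasing sequence of closed relations, and compactness with separation by gates
makes the intersection the graph of a homeomorphism.

Under the doubling condition, changing the finite generating set is bi-Lipschitz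
(`exists_change_lipschitz`), so the statement passes to all generating sets. -/

theorem exists_injective_choice {α β : Type*} [Countable α] (s : α → Set β)
    (hs : ∀ a, (s a).Infinite) : ∃ g : α → β, Function.Injective g ∧ ∀ a, g a ∈ s a := by
  classical
  obtain ⟨e, he⟩ := Countable.exists_injective_nat α
  -- With `e a + 1` candidates for `a`, Hall's condition holds: the largest candidate set indexed by
  -- `u` already has at least `u.card` elements.
  choose t hts htc using fun a => (hs a).exists_subset_card_eq (e a + 1)
  have hall := (Finset.all_card_le_biUnion_card_iff_exists_injective t).1 (fun u => by
    rcases u.eq_empty_or_nonempty with rfl | hu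
    · simp
    obtain ⟨x, hx, hmax⟩ := u.exists_max_image e hu
    calc u.card = (u.image e).card := (Finset.card_image_of_injective u he).symm
      _ ≤ (Finset.range (e x + 1)).card := Finset.card_le_card (by
          intro m hm
          obtain ⟨y, hy, rfl⟩ := Finset.mem_image.1 hm
          exact Finset.mem_range.2 (Nat.lt_succ_of_le (hmax y hy)))
      _ = (t x).card := by rw [Finset.card_range, htc]
      _ ≤ _ := Finset.card_le_card (Finset.subset_biUnion_of_mem t hx))
  obtain ⟨g, hg, hgt⟩ := hall
  exact ⟨g, hg, fun a => hts a (hgt a)⟩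

theorem infinite_inter_of_mem_closure {K : Type*} [TopologicalSpace K] [T1Space K] {D O : Set K}
    {x : K} (hx : x ∈ closure D) (hxD : x ∉ D) (hO : IsOpen O) (hxO : x ∈ O) :
    (O ∩ D).Infinite := by
  intro hfin
  have := hO.inter_closure ⟨hxO, hx⟩
  rw [hfin.isClosed.closure_eq] at this
  exact hxD this.2

/-- Half of the property of being a bijective relation between `A ∪ B` and `A' ∪ B'`, matching
`A` with `A'` and `B` with `B'`. -/
structure HalfMatching {K K' : Type*} (Γ : Set (K × K')) (X D : Set K) (X' D' : Set K') :
    Prop where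
  sub : ∀ p ∈ Γ, (p.1 ∈ X ∧ p.2 ∈ X') ∨ (p.1 ∈ D ∧ p.2 ∈ D')
  total : ∀ a, a ∈ X ∨ a ∈ D → ∃ b, (a, b) ∈ Γ
  func : ∀ a b b', (a, b) ∈ Γ → (a, b') ∈ Γ → b = b'

section matching

variable {K K' : Type*} [MetricSpace K] [MetricSpace K'] [CompactSpace K] [CompactSpace K']
  {X D : Set K} {X' D' : Set K'}

theorem isClosed_of_open_singletons {K : Type*} [TopologicalSpace K] {X : Set K}
    (hX : ∀ a ∉ X, IsOpen {a}) : IsClosed X := by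
  rw [← isOpen_compl_iff, ← biUnion_of_singleton Xᶜ]
  exact isOpen_biUnion hX

/-- A nearest-point map onto the compact set `X` moves `a` by at most `dist a x`. It need not be
continuous, but it is so at the points of `X`. -/
theorem exists_nearest (hX : ∀ a ∉ X, IsOpen {a}) (hne : X.Nonempty) :
    ∃ ρ : K → X, ∀ x ∈ X, Tendsto (fun a => (ρ a : K)) (𝓝 x) (𝓝 x) := by
  have hc := (isClosed_of_open_singletons hX).isCompact
  choose ρ hρ hd using hc.exists_infDist_eq_dist hne
  refine ⟨fun a => ⟨ρ a, hρ a⟩, fun x hx => ?_⟩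
  rw [tendsto_iff_dist_tendsto_zero]
  have hb : ∀ a, dist (ρ a) x ≤ 2 * dist a x := fun a => by
    have h1 := dist_triangle (ρ a) a x
    have h2 : dist (ρ a) a ≤ dist a x := by
      rw [dist_comm, ← hd]; exact Metric.infDist_le_dist_of_mem hx
    linarith
  refine squeeze_zero (fun _ => dist_nonneg) hb ?_
  have : Tendsto (fun a => 2 * dist a x) (𝓝 x) (𝓝 (2 * dist x x)) :=
    (continuous_const.mul (continuous_id.dist continuous_const)).tendsto x
  simpa using this

/-- Every ball about a point of `X'` meets `D'` in infinitely many points, so there is room for an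
injection. With `e` injective, the error tends to zero along `D`. -/
theorem exists_controlled_injection {K K' : Type*} [MetricSpace K'] {D : Set K} {X' D' : Set K'}
    (hD' : ∀ a ∈ D', a ∉ X') (hDc : D.Countable) (hcl' : X' ⊆ closure D') (φ : K → X') (e : D → ℕ) :
    ∃ g : D → D', Function.Injective g ∧
      ∀ a, dist (g a : K') (φ a) < 1 / ((e a : ℝ) + 1) := by
  have := hDc.to_subtype
  refine exists_injective_choice
    (fun a : D => {b : D' | dist (b : K') (φ a) < 1 / ((e a : ℝ) + 1)}) fun a => ?_
  have hinf := infinite_inter_of_mem_closure (hcl' (φ a).2) (fun h => hD' _ h (φ a).2)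
    (Metric.isOpen_ball (x := (φ a : K')) (ε := 1 / ((e a : ℝ) + 1)))
    (Metric.mem_ball_self (by positivity))
  refine Infinite.of_image (fun b : D' => (b : K')) (hinf.mono ?_)
  rintro b ⟨hb, hbD⟩
  exact ⟨⟨b, hbD⟩, hb, rfl⟩

theorem eventually_notMem_initial {K : Type*} [MetricSpace K] {D : Set K} {u : K} (hu : u ∉ D) {e : D → ℕ}
    (he : Function.Injective e) (N : ℕ) : ∀ᶠ a in 𝓝 u, ∀ h : a ∈ D, N < e ⟨a, h⟩ := by
  have hfin : ((fun a : D => (a : K)) '' {a | e a ≤ N}).Finite :=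
    (Set.Finite.preimage he.injOn (Set.finite_le_nat N)).image _
  filter_upwards [hfin.isClosed.isOpen_compl.mem_nhds (x := u) (by
    rintro ⟨a, -, rfl⟩; exact hu a.2)] with a ha h
  by_contra hle
  exact ha ⟨⟨a, h⟩, not_lt.1 hle, rfl⟩

theorem eventually_far {A B : Type*} [MetricSpace B] {l : Filter A} {φ ψ : A → B} {x y : B}
    (hφ : Tendsto φ l (𝓝 x)) (hψ : Tendsto ψ l (𝓝 y)) (hxy : x ≠ y) :
    ∃ N : ℕ, ∀ᶠ a in l, 1 / ((N : ℝ) + 1) < dist (φ a) (ψ a) := by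
  obtain ⟨N, hN⟩ := exists_nat_one_div_lt (dist_pos.2 hxy)
  exact ⟨N, (hφ.dist hψ).eventually (lt_mem_nhds hN)⟩

/-- Two compactifications of countable discrete sets with homeomorphic remainders are matched
by a closed bijective relation extending the given homeomorphism. -/
theorem exists_matching (hX : ∀ a ∉ X, IsOpen {a}) (hX' : ∀ a ∉ X', IsOpen {a})
    (hne : X.Nonempty) (h : X ≃ₜ X') (hD : ∀ a ∈ D, a ∉ X) (hD' : ∀ a ∈ D', a ∉ X')
    (hDc : D.Countable) (hDc' : D'.Countable) (hcl : X ⊆ closure D) (hcl' : X' ⊆ closure D') :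
    ∃ Γ : Set (K × K'), IsClosed Γ ∧ HalfMatching Γ X D X' D' ∧
      HalfMatching (Prod.swap ⁻¹' Γ) X' D' X D := by
  obtain ⟨x₀, hx₀⟩ := hne
  have hne' : X'.Nonempty := ⟨_, (h ⟨x₀, hx₀⟩).2⟩
  obtain ⟨ρ, hρ⟩ := exists_nearest hX ⟨x₀, hx₀⟩
  obtain ⟨ρ', hρ'⟩ := exists_nearest hX' hne'
  obtain ⟨e, he⟩ := @Countable.exists_injective_nat D hDc.to_subtype
  obtain ⟨e', he'⟩ := @Countable.exists_injective_nat D' hDc'.to_subtype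
  obtain ⟨g, hg, hgd⟩ := exists_controlled_injection hD' hDc hcl' (fun a => h (ρ a)) e
  obtain ⟨g', hg', hgd'⟩ :=
    exists_controlled_injection hD hDc' hcl (fun a => h.symm (ρ' a)) e'
  -- The bijection follows `g` at some points and the inverse of `g'` at the others, so each matched
  -- pair satisfies at least one of the two closeness estimates.
  obtain ⟨σ, hσ, hσd⟩ := Function.Embedding.schroeder_bernstein_of_rel hg hg'
    (fun a b => dist (b : K') (h (ρ a)) < 1 / ((e a : ℝ) + 1) ∨
      dist (a : K) (h.symm (ρ' b)) < 1 / ((e' b : ℝ) + 1))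
    (fun a => Or.inl (hgd a)) (fun b => Or.inr (hgd' b))
  set Γ : Set (K × K') := {p | (∃ x : X, p = (↑x, ↑(h x))) ∨ ∃ a : D, p = (↑a, ↑(σ a))} with hΓ
  have h1 : HalfMatching Γ X D X' D' := by
    refine ⟨?_, ?_, ?_⟩
    · rintro p (⟨x, rfl⟩ | ⟨a, rfl⟩)
      · exact Or.inl ⟨x.2, (h x).2⟩
      · exact Or.inr ⟨a.2, (σ a).2⟩
    · rintro a (ha | ha)
      · exact ⟨_, Or.inl ⟨⟨a, ha⟩, rfl⟩⟩
      · exact ⟨_, Or.inr ⟨⟨a, ha⟩, rfl⟩⟩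
    · rintro a b b' (⟨x, hx⟩ | ⟨x, hx⟩) (⟨y, hy⟩ | ⟨y, hy⟩) <;>
        simp only [Prod.mk.injEq] at hx hy
      · have : x = y := Subtype.ext (hx.1.symm.trans hy.1)
        rw [hx.2, hy.2, this]
      · exact absurd (hx.1 ▸ x.2) (hD _ (hy.1 ▸ y.2))
      · exact absurd (hy.1 ▸ y.2) (hD _ (hx.1 ▸ x.2))
      · have : x = y := Subtype.ext (hx.1.symm.trans hy.1)
        rw [hx.2, hy.2, this]
  have h2 : HalfMatching (Prod.swap ⁻¹' Γ) X' D' X D := by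
    refine ⟨?_, ?_, ?_⟩
    · rintro p hp
      rcases h1.sub _ hp with h | h
      · exact Or.inl h.symm
      · exact Or.inr h.symm
    · rintro b (hb | hb)
      · exact ⟨h.symm ⟨b, hb⟩, Or.inl ⟨h.symm ⟨b, hb⟩, by simp⟩⟩
      · obtain ⟨a, ha⟩ := hσ.2 ⟨b, hb⟩
        exact ⟨a, Or.inr ⟨a, by simp [ha]⟩⟩
    · rintro a b b' (⟨x, hx⟩ | ⟨x, hx⟩) (⟨y, hy⟩ | ⟨y, hy⟩) <;>
        simp only [Prod.swap_prod_mk, Prod.mk.injEq] at hx hy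
      · have : x = y := h.injective (Subtype.ext (hx.2.symm.trans hy.2))
        rw [hx.1, hy.1, this]
      · exact absurd (hx.2 ▸ (h x).2) (hD' _ (hy.2 ▸ (σ y).2))
      · exact absurd (hy.2 ▸ (h y).2) (hD' _ (hx.2 ▸ (σ x).2))
      · have : x = y := hσ.1 (Subtype.ext (hx.2.symm.trans hy.2))
        rw [hx.1, hy.1, this]
  refine ⟨Γ, ?_, h1, h2⟩
  -- Off the remainders one coordinate is isolated, and functionality of the relation suffices. Over
  -- remainder points with `v ≠ h u`, matched pairs near `(u, v)` would have large index, hence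
  -- small error, while their distance to the prescribed target stays bounded below.
  rw [← isOpen_compl_iff, isOpen_iff_eventually]
  rintro ⟨u, v⟩ huv
  have tfst : Tendsto Prod.fst (𝓝 (u, v)) (𝓝 u) := continuous_fst.tendsto (u, v)
  have tsnd : Tendsto Prod.snd (𝓝 (u, v)) (𝓝 v) := continuous_snd.tendsto (u, v)
  by_cases hu : u ∈ X
  swap
  · have hev : ∀ᶠ p : K × K' in 𝓝 (u, v), p.1 = u := tfst ((hX u hu).mem_nhds rfl)
    by_cases hw : ∃ w, (u, w) ∈ Γ
    · obtain ⟨w, hw⟩ := hw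
      have hvw : v ≠ w := fun h => huv (h ▸ hw)
      filter_upwards [hev, tsnd.eventually_ne hvw] with p hp hp' hpΓ
      exact hp' (h1.func u _ _ (by rw [← hp]; exact hpΓ) hw)
    · filter_upwards [hev] with p hp hpΓ
      exact hw ⟨p.2, by rw [← hp]; exact hpΓ⟩
  by_cases hv : v ∈ X'
  swap
  · have hev : ∀ᶠ p : K × K' in 𝓝 (u, v), p.2 = v := tsnd ((hX' v hv).mem_nhds rfl)
    by_cases hw : ∃ w, (w, v) ∈ Γ
    · obtain ⟨w, hw⟩ := hw
      have hvw : u ≠ w := fun h => huv (h ▸ hw)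
      filter_upwards [hev, tfst.eventually_ne hvw] with p hp hp' hpΓ
      exact hp' (h2.func v _ _ (by rw [← hp]; exact hpΓ) hw)
    · filter_upwards [hev] with p hp hpΓ
      exact hw ⟨p.1, by rw [← hp]; exact hpΓ⟩
  have hne1 : v ≠ h ⟨u, hu⟩ := fun hh => huv (Or.inl ⟨⟨u, hu⟩, by rw [hh]⟩)
  have hne2 : u ≠ h.symm ⟨v, hv⟩ := by
    intro hh
    have : (⟨u, hu⟩ : X) = h.symm ⟨v, hv⟩ := Subtype.ext hh
    exact hne1 (by rw [this]; simp)
  have t1 : Tendsto (fun p : K × K' => ((h (ρ p.1) : X') : K')) (𝓝 (u, v)) (𝓝 (h ⟨u, hu⟩)) := by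
    have : Tendsto (fun p : K × K' => ρ p.1) (𝓝 (u, v)) (𝓝 ⟨u, hu⟩) :=
      tendsto_subtype_rng.2 ((hρ u hu).comp tfst)
    exact ((continuous_subtype_val.comp h.continuous).tendsto _).comp this
  have t2 : Tendsto (fun p : K × K' => ((h.symm (ρ' p.2) : X) : K)) (𝓝 (u, v))
      (𝓝 (h.symm ⟨v, hv⟩)) := by
    have : Tendsto (fun p : K × K' => ρ' p.2) (𝓝 (u, v)) (𝓝 ⟨v, hv⟩) :=
      tendsto_subtype_rng.2 ((hρ' v hv).comp tsnd)
    exact ((continuous_subtype_val.comp h.symm.continuous).tendsto _).comp this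
  obtain ⟨N, hN⟩ := eventually_far tsnd t1 hne1
  obtain ⟨N', hN'⟩ := eventually_far tfst t2 hne2
  have hgraph : ∀ᶠ p : K × K' in 𝓝 (u, v), ∀ x : X, p ≠ (↑x, ↑(h x)) := by
    obtain ⟨O, O', hO, hO', hu', hv', hdis⟩ := t2_separation hne1
    have hc : Tendsto (fun x : X => ((h x : X') : K')) (𝓝 ⟨u, hu⟩) (𝓝 (h ⟨u, hu⟩)) :=
      (continuous_subtype_val.comp h.continuous).tendsto _
    have hc' := hc (hO'.mem_nhds hv')
    rw [Filter.mem_map, nhds_subtype, Filter.mem_comap] at hc'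
    obtain ⟨W, hW, hWO⟩ := hc'
    filter_upwards [tfst hW, tsnd (hO.mem_nhds hu')] with p hp hp' x hpx
    subst hpx
    exact disjoint_left.1 hdis hp' (hWO hp)
  filter_upwards [hN, hN', hgraph,
    tfst.eventually (eventually_notMem_initial (fun h => hD u h hu) he N),
    tsnd.eventually (eventually_notMem_initial (fun h => hD' v h hv) he' N')]
    with p hp hp' hpg hpe hpe' hpΓ
  rcases hpΓ with ⟨x, hx⟩ | ⟨a, ha⟩
  · exact hpg x hx
  subst ha
  have k1 := hpe a.2
  have k2 := hpe' (σ a).2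
  have mono : ∀ m n : ℕ, m < n → 1 / ((n : ℝ) + 1) ≤ 1 / ((m : ℝ) + 1) := fun m n hmn =>
    Nat.one_div_le_one_div hmn.le
  rcases hσd a with hd | hd
  · exact absurd (hp.trans hd) (not_lt.2 (mono _ _ k1))
  · exact absurd (hp'.trans hd) (not_lt.2 (mono _ _ k2))

end matching

end Floyd

/-! ### Gate systems and good clopen sets. -/

namespace Floyd

open Topology Filter Set

/-- A gate system presents `Z` as a tree-like union of remainders: every index `i` carries a
compactification `K i` of a discrete set with remainder `X i`, and a gate map `Z → K i`. -/
structure GateSystem (Z : Type*) [TopologicalSpace Z] {I κ : Type*} (K : I → Type*)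
    [∀ i, TopologicalSpace (K i)] (X : ∀ i, Set (K i)) (color : I → κ) where
  /-- the gate maps -/
  gate : ∀ i, Z → K i
  /-- the gate in `K j` of the piece with index `i` -/
  base : I → ∀ j, K j
  continuous_gate : ∀ i, Continuous (gate i)
  isOpen_singleton : ∀ i, ∀ a ∉ X i, IsOpen {a}
  countable : ∀ i, (X i)ᶜ.Countable
  nonempty : ∀ i, (X i).Nonempty
  base_notMem : ∀ i j, i ≠ j → base i j ∉ X j
  tree : ∀ i j, i ≠ j → ∀ z, gate j z = base i j ∨ gate i z = base j i
  separating : ∀ z z', (∀ i, gate i z = gate i z') → z = z'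
  surjective : ∀ i, ∀ x ∈ X i, ∃ z, gate i z = x
  dense : ∀ c, ∀ U : Set Z, IsOpen U → U.Nonempty → ∃ i, color i = c ∧ ∃ z ∈ U, gate i z ∈ X i

namespace GateSystem

variable {Z : Type*} [TopologicalSpace Z] {I κ : Type*} {K : I → Type*}
  [∀ i, TopologicalSpace (K i)] {X : ∀ i, Set (K i)} {color : I → κ}
  (𝒢 : GateSystem Z K X color)

/-- A nonempty clopen set such that every piece lies inside it or has a constant gate on it. -/
structure Good (U : Set Z) : Prop where
  isClopen : IsClopen U
  nonempty : U.Nonempty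
  dichotomy : ∀ i, (∀ z, 𝒢.gate i z ∈ X i → z ∈ U) ∨ ∃ d ∉ X i, ∀ z ∈ U, 𝒢.gate i z = d

theorem good_univ [Nonempty Z] : 𝒢.Good univ :=
  ⟨isClopen_univ, univ_nonempty, fun _ => Or.inl fun _ _ => mem_univ _⟩

variable {𝒢}

theorem Good.subset_of_mem {U : Set Z} (hU : 𝒢.Good U) {i : I} {z : Z} (hz : z ∈ U)
    (hzi : 𝒢.gate i z ∈ X i) : ∀ z, 𝒢.gate i z ∈ X i → z ∈ U := by
  rcases hU.dichotomy i with h | ⟨d, hd, h⟩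
  · exact h
  · exact absurd (h z hz ▸ hzi) hd

/-- The fibre over an isolated point is clopen. By the tree axiom, a piece `i ≠ j` projects to the
single point `base i j` of `K j`: if this is `a`, the piece lies in the fibre; if not, the gate in
`K i` is `base j i` on all of the fibre. -/
theorem Good.inter_gate [∀ i, T1Space (K i)] {U : Set Z} (hU : 𝒢.Good U) {j : I}
    {a : K j} (ha : a ∉ X j) (hne : (U ∩ 𝒢.gate j ⁻¹' {a}).Nonempty) :
    𝒢.Good (U ∩ 𝒢.gate j ⁻¹' {a}) := by
  refine ⟨hU.isClopen.inter ⟨isClosed_singleton.preimage (𝒢.continuous_gate j),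
    (𝒢.isOpen_singleton j a ha).preimage (𝒢.continuous_gate j)⟩, hne, fun i => ?_⟩
  rcases hU.dichotomy i with h | ⟨d, hd, h⟩
  swap
  · exact Or.inr ⟨d, hd, fun z hz => h z hz.1⟩
  by_cases hij : i = j
  · subst hij
    exact Or.inr ⟨a, ha, fun z hz => hz.2⟩
  by_cases hb : 𝒢.base i j = a
  · refine Or.inl fun z hz => ⟨h z hz, ?_⟩
    rcases 𝒢.tree i j hij z with h' | h'
    · exact h'.trans hb
    · exact absurd (h' ▸ hz) (𝒢.base_notMem j i (Ne.symm hij))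
  · refine Or.inr ⟨_, 𝒢.base_notMem j i (Ne.symm hij), fun z hz => ?_⟩
    rcases 𝒢.tree i j hij z with h' | h'
    · exact absurd (h'.symm.trans hz.2) hb
    · exact h'

/-- A gate in the remainder forces every other gate to be `base i j`, so the separation axiom
applies. -/
theorem eq_of_gate_eq {i : I} {z z' : Z} (hz : 𝒢.gate i z ∈ X i)
    (h : 𝒢.gate i z = 𝒢.gate i z') : z = z' := by
  refine 𝒢.separating z z' fun j => ?_
  by_cases hij : i = j
  · subst hij; exact h
  have key : ∀ y, 𝒢.gate i y ∈ X i → 𝒢.gate j y = 𝒢.base i j := fun y hy =>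
    (𝒢.tree i j hij y).resolve_right
      fun h' => 𝒢.base_notMem j i (Ne.symm hij) (h' ▸ hy)
  rw [key z hz, key z' (h ▸ hz)]

theorem Good.exists_color {U : Set Z} (hU : 𝒢.Good U) (c : κ) :
    ∃ i, color i = c ∧ ∀ z, 𝒢.gate i z ∈ X i → z ∈ U := by
  obtain ⟨i, hi, z, hz, hzi⟩ := 𝒢.dense c U hU.isClopen.isOpen hU.nonempty
  exact ⟨i, hi, hU.subset_of_mem hz hzi⟩

/-- Near a point of the piece `j` there are pieces of another colour, and these have isolated gates
in `K j`. This is where a second colour is needed. -/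
theorem Good.subset_closure [Nontrivial κ] {U : Set Z} (hU : 𝒢.Good U) {j : I}
    (hj : ∀ z, 𝒢.gate j z ∈ X j → z ∈ U) : X j ⊆ closure (𝒢.gate j '' U \ X j) := by
  intro x hx
  obtain ⟨z, rfl⟩ := 𝒢.surjective j x hx
  rw [mem_closure_iff]
  intro O hO hxO
  obtain ⟨c, hc⟩ := exists_ne (color j)
  obtain ⟨k, hk, y, hy, hyk⟩ := 𝒢.dense c (U ∩ 𝒢.gate j ⁻¹' O)
    (hU.isClopen.isOpen.inter (hO.preimage (𝒢.continuous_gate j))) ⟨z, hj z hx, hxO⟩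
  have hkj : k ≠ j := by rintro rfl; exact hc hk.symm
  refine ⟨_, hy.2, ⟨y, hy.1, rfl⟩, ?_⟩
  rcases 𝒢.tree k j hkj y with h' | h'
  · rw [h']; exact 𝒢.base_notMem k j hkj
  · exact absurd (h' ▸ hyk) (𝒢.base_notMem j k (Ne.symm hkj))

end GateSystem

/-! ### Approximations of a homeomorphism and their refinement. -/

/-- Half of the axioms for an approximation `E` of a homeomorphism between `U` and `V`, which is
a bijection except on the blocks in `L`, where it relates everything to everything. -/
structure HalfStage {Z Z' : Type*} (U : Set Z) (V : Set Z') (E : Set (Z × Z'))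
    (L : Set (Set Z × Set Z')) : Prop where
  sub : ∀ p ∈ E, p.1 ∈ U ∧ p.2 ∈ V
  total : ∀ z ∈ U, ∃ z', (z, z') ∈ E
  sub_block : ∀ p ∈ L, p.1 ⊆ U
  block : ∀ p ∈ L, ∀ z ∈ p.1, ∀ z', (z, z') ∈ E ↔ z' ∈ p.2
  func : ∀ z z' z'', (z, z') ∈ E → (z, z'') ∈ E → z' = z'' ∨ ∃ p ∈ L, z ∈ p.1
  disj : ∀ p ∈ L, ∀ q ∈ L, ∀ z ∈ p.1, z ∈ q.1 → p = q

/-- The refinement of an approximation by approximations on its blocks. -/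
def refineRel {Z Z' : Type*} (E : Set (Z × Z')) (L : Set (Set Z × Set Z'))
    (E' : Set Z × Set Z' → Set (Z × Z')) : Set (Z × Z') :=
  {q | q ∈ E ∧ ∀ p ∈ L, q.1 ∈ p.1 → q.2 ∈ p.2 → q ∈ E' p}

/-- The blocks of the refinement of an approximation. -/
def refineBlocks {Z Z' : Type*} (L : Set (Set Z × Set Z'))
    (L' : Set Z × Set Z' → Set (Set Z × Set Z')) : Set (Set Z × Set Z') :=
  {q | ∃ p ∈ L, q ∈ L' p}

theorem HalfStage.trivial {Z Z' : Type*} (U : Set Z) {V : Set Z'} (hV : V.Nonempty) :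
    HalfStage U V (U ×ˢ V) {(U, V)} := by
  obtain ⟨v, hv⟩ := hV
  refine ⟨fun p hp => hp, fun z hz => ⟨v, hz, hv⟩, ?_, ?_, ?_, ?_⟩
  · rintro p rfl
    exact subset_rfl
  · rintro p rfl z hz z'
    exact ⟨fun h => h.2, fun h => ⟨hz, h⟩⟩
  · exact fun z z' z'' h1 _ => Or.inr ⟨_, rfl, h1.1⟩
  · rintro p rfl q rfl z _ _
    rfl

/-- On a block the relation is the full product and the blocks are disjoint, so each can be replaced
independently without disturbing the rest. -/
theorem HalfStage.refine {Z Z' : Type*} {U : Set Z} {V : Set Z'} {E : Set (Z × Z')}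
    {L : Set (Set Z × Set Z')} (h : HalfStage U V E L) {E' : Set Z × Set Z' → Set (Z × Z')}
    {L' : Set Z × Set Z' → Set (Set Z × Set Z')}
    (h' : ∀ p ∈ L, HalfStage p.1 p.2 (E' p) (L' p)) :
    HalfStage U V (refineRel E L E') (refineBlocks L L') := by
  refine ⟨fun p hp => h.sub p hp.1, fun z hz => ?_, ?_, ?_, ?_, ?_⟩
  · by_cases hp : ∃ p ∈ L, z ∈ p.1
    · obtain ⟨p, hp, hzp⟩ := hp
      obtain ⟨z', hz'⟩ := (h' p hp).total z hzp
      refine ⟨z', (h.block p hp z hzp z').2 ((h' p hp).sub _ hz').2, fun q hq hzq _ => ?_⟩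
      rwa [h.disj q hq p hp z hzq hzp]
    · obtain ⟨z', hz'⟩ := h.total z hz
      exact ⟨z', hz', fun q hq hzq _ => absurd ⟨q, hq, hzq⟩ hp⟩
  · rintro q ⟨p, hp, hq⟩
    exact ((h' p hp).sub_block q hq).trans (h.sub_block p hp)
  · rintro q ⟨p, hp, hq⟩ z hz z'
    have hzp := (h' p hp).sub_block q hq hz
    rw [← (h' p hp).block q hq z hz z']
    constructor
    · rintro ⟨hE, hall⟩
      exact hall p hp hzp ((h.block p hp z hzp z').1 hE)
    · intro hE
      refine ⟨(h.block p hp z hzp z').2 ((h' p hp).sub _ hE).2, fun r hr hzr _ => ?_⟩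
      rwa [h.disj r hr p hp z hzr hzp]
  · rintro z z' z'' h1 h2
    rcases h.func z z' z'' h1.1 h2.1 with heq | ⟨p, hp, hzp⟩
    · exact Or.inl heq
    · have e1 := h1.2 p hp hzp ((h.block p hp z hzp _).1 h1.1)
      have e2 := h2.2 p hp hzp ((h.block p hp z hzp _).1 h2.1)
      rcases (h' p hp).func z z' z'' e1 e2 with heq | ⟨q, hq, hzq⟩
      · exact Or.inl heq
      · exact Or.inr ⟨q, ⟨p, hp, hq⟩, hzq⟩
  · rintro q₁ ⟨p₁, hp₁, hq₁⟩ q₂ ⟨p₂, hp₂, hq₂⟩ z hz₁ hz₂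
    obtain rfl := h.disj p₁ hp₁ p₂ hp₂ z ((h' _ hp₁).sub_block _ hq₁ hz₁)
      ((h' _ hp₂).sub_block _ hq₂ hz₂)
    exact (h' _ hp₁).disj _ hq₁ _ hq₂ z hz₁ hz₂

variable {Z Z' : Type*} [TopologicalSpace Z] [TopologicalSpace Z'] {I I' κ : Type*}
  {K : I → Type*} {K' : I' → Type*} [∀ i, TopologicalSpace (K i)] [∀ i, TopologicalSpace (K' i)]
  {X : ∀ i, Set (K i)} {X' : ∀ i, Set (K' i)} {color : I → κ} {color' : I' → κ}

/-- An approximation of a homeomorphism between `U` and `V`. -/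
structure Stage (𝒢 : GateSystem Z K X color) (𝒢' : GateSystem Z' K' X' color')
    (U : Set Z) (V : Set Z') (E : Set (Z × Z')) (L : Set (Set Z × Set Z')) : Prop where
  isClosed : IsClosed E
  good : ∀ p ∈ L, 𝒢.Good p.1 ∧ 𝒢'.Good p.2
  left : HalfStage U V E L
  right : HalfStage V U (Prod.swap ⁻¹' E) (Prod.swap ⁻¹' L)

variable {𝒢 : GateSystem Z K X color} {𝒢' : GateSystem Z' K' X' color'}

theorem Stage.swap {U : Set Z} {V : Set Z'} {E : Set (Z × Z')} {L : Set (Set Z × Set Z')}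
    (h : Stage 𝒢 𝒢' U V E L) : Stage 𝒢' 𝒢 V U (Prod.swap ⁻¹' E) (Prod.swap ⁻¹' L) :=
  ⟨h.isClosed.preimage continuous_swap, fun _ hp => (h.good _ hp).symm, h.right, h.left⟩

theorem Stage.trivial {U : Set Z} {V : Set Z'} (hU : 𝒢.Good U) (hV : 𝒢'.Good V) :
    Stage 𝒢 𝒢' U V (U ×ˢ V) {(U, V)} := by
  refine ⟨hU.isClopen.isClosed.prod hV.isClopen.isClosed, ?_, HalfStage.trivial U hV.nonempty, ?_⟩
  · rintro p rfl
    exact ⟨hU, hV⟩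
  · have h1 : Prod.swap ⁻¹' (U ×ˢ V) = V ×ˢ U := by ext; simp [and_comm]
    have h2 : Prod.swap ⁻¹' {(U, V)} = ({(V, U)} : Set (Set Z' × Set Z)) := by
      ext ⟨a, b⟩; simp [and_comm]
    rw [h1, h2]
    exact HalfStage.trivial V hU.nonempty

theorem Stage.refine {U : Set Z} {V : Set Z'} {E : Set (Z × Z')} {L : Set (Set Z × Set Z')}
    (h : Stage 𝒢 𝒢' U V E L) {E' : Set Z × Set Z' → Set (Z × Z')}
    {L' : Set Z × Set Z' → Set (Set Z × Set Z')}
    (h' : ∀ p ∈ L, Stage 𝒢 𝒢' p.1 p.2 (E' p) (L' p)) :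
    Stage 𝒢 𝒢' U V (refineRel E L E') (refineBlocks L L') := by
  refine ⟨?_, ?_, h.left.refine fun p hp => (h' p hp).left, ?_⟩
  -- Each constraint is closed because the blocks are open; no finiteness of `L` is needed.
  · have : refineRel E L E' = E ∩ ⋂ p ∈ L, ((p.1 ×ˢ p.2)ᶜ ∪ E' p) := by
      ext ⟨z, z'⟩
      simp only [refineRel, mem_ofPred_eq, mem_inter_iff, mem_iInter, mem_union, mem_compl_iff,
        mem_prod, not_and, imp_iff_not_or, or_assoc]
    rw [this]
    refine h.isClosed.inter (isClosed_biInter fun p hp => IsClosed.union ?_ (h' p hp).isClosed)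
    exact ((h.good p hp).1.isClopen.isOpen.prod (h.good p hp).2.isClopen.isOpen).isClosed_compl
  · rintro q ⟨p, hp, hq⟩
    exact (h' p hp).good q hq
  · have := h.right.refine (E' := fun p => Prod.swap ⁻¹' (E' p.swap))
      (L' := fun p => Prod.swap ⁻¹' (L' p.swap)) fun p hp => (h' _ hp).right
    convert this using 1
    · ext ⟨z, z'⟩
      simp only [refineRel, mem_preimage, mem_ofPred_eq, Prod.swap_prod_mk, Prod.forall]
      constructor
      · exact fun ⟨h1, h2⟩ => ⟨h1, fun b a hab h3 h4 => h2 a b hab h4 h3⟩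
      · exact fun ⟨h1, h2⟩ => ⟨h1, fun a b hab h3 h4 => h2 b a hab h4 h3⟩
    · ext ⟨z, z'⟩
      simp only [refineBlocks, mem_preimage, mem_ofPred_eq, Prod.swap_prod_mk, Prod.exists]
      constructor
      · exact fun ⟨a, b, h1, h2⟩ => ⟨b, a, h1, h2⟩
      · exact fun ⟨a, b, h1, h2⟩ => ⟨b, a, h1, h2⟩

/-- The half of the construction of the first approximation on a pair of good sets. -/
theorem halfStage_of_matching {U : Set Z} {V : Set Z'} {j : I} {k : I'}
    (hk : ∀ z, 𝒢'.gate k z ∈ X' k → z ∈ V) {Γ : Set (K j × K' k)}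
    (hΓ : HalfMatching Γ (X j) (𝒢.gate j '' U \ X j) (X' k) (𝒢'.gate k '' V \ X' k)) :
    HalfStage U V {p | p.1 ∈ U ∧ p.2 ∈ V ∧ (𝒢.gate j p.1, 𝒢'.gate k p.2) ∈ Γ}
      {q | ∃ a b, a ∉ X j ∧ (a, b) ∈ Γ ∧
        q = (U ∩ 𝒢.gate j ⁻¹' {a}, V ∩ 𝒢'.gate k ⁻¹' {b})} := by
  refine ⟨fun p hp => ⟨hp.1, hp.2.1⟩, fun z hz => ?_, ?_, ?_, ?_, ?_⟩
  · by_cases hx : 𝒢.gate j z ∈ X j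
    · obtain ⟨b, hb⟩ := hΓ.total _ (Or.inl hx)
      rcases hΓ.sub _ hb with h | h
      · obtain ⟨z', rfl⟩ := 𝒢'.surjective k b h.2
        exact ⟨z', hz, hk z' h.2, hb⟩
      · exact absurd hx h.1.2
    · obtain ⟨b, hb⟩ := hΓ.total _ (Or.inr ⟨⟨z, hz, rfl⟩, hx⟩)
      rcases hΓ.sub _ hb with h | h
      · exact absurd h.1 hx
      · obtain ⟨⟨z', hz', rfl⟩, -⟩ := h.2
        exact ⟨z', hz, hz', hb⟩
  · rintro q ⟨a, b, -, -, rfl⟩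
    exact inter_subset_left
  · rintro q ⟨a, b, ha, hab, rfl⟩ z ⟨hz, rfl⟩ z'
    constructor
    · rintro ⟨-, hz', hE⟩
      exact ⟨hz', hΓ.func _ _ _ hE hab⟩
    · rintro ⟨hz', rfl⟩
      exact ⟨hz, hz', hab⟩
  · rintro z z' z'' ⟨hz, hz', h1⟩ ⟨-, hz'', h2⟩
    by_cases hx : 𝒢.gate j z ∈ X j
    -- Over the remainder, a point of `V` is determined by its gate alone, so there is no ambiguity
    -- outside the blocks.
    · left
      refine GateSystem.eq_of_gate_eq (i := k) ?_ (hΓ.func _ _ _ h1 h2)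
      exact (hΓ.sub _ h1).elim (fun h => h.2) fun h => absurd hx h.1.2
    · exact Or.inr ⟨_, ⟨_, _, hx, h1, rfl⟩, hz, rfl⟩
  · rintro p ⟨a, b, ha, hab, rfl⟩ q ⟨a', b', ha', hab', rfl⟩ z ⟨_, rfl⟩ ⟨_, rfl⟩
    rw [hΓ.func _ _ _ hab hab']

/-- Matching pieces of the same colour in two good sets gives an approximation. -/
theorem exists_stage [Nontrivial κ] [∀ i, CompactSpace (K i)] [∀ i, CompactSpace (K' i)]
    [∀ i, TopologicalSpace.MetrizableSpace (K i)] [∀ i, TopologicalSpace.MetrizableSpace (K' i)]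
    {U : Set Z} {V : Set Z'} (hU : 𝒢.Good U) (hV : 𝒢'.Good V) {j : I} {k : I'}
    (hj : ∀ z, 𝒢.gate j z ∈ X j → z ∈ U) (hk : ∀ z, 𝒢'.gate k z ∈ X' k → z ∈ V)
    (h : X j ≃ₜ X' k) : ∃ E L, Stage 𝒢 𝒢' U V E L ∧
      ∀ p ∈ L, ∃ a, ∀ z ∈ p.1, 𝒢.gate j z = a := by
  let _ := TopologicalSpace.metrizableSpaceMetric (K j)
  let _ := TopologicalSpace.metrizableSpaceMetric (K' k)
  obtain ⟨Γ, hΓc, hΓ, hΓ'⟩ := exists_matching (𝒢.isOpen_singleton j) (𝒢'.isOpen_singleton k)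
    (𝒢.nonempty j) h (D := 𝒢.gate j '' U \ X j) (D' := 𝒢'.gate k '' V \ X' k)
    (fun _ ha => ha.2) (fun _ ha => ha.2) ((𝒢.countable j).mono fun _ ha => ha.2)
    ((𝒢'.countable k).mono fun _ ha => ha.2) (hU.subset_closure hj) (hV.subset_closure hk)
  refine ⟨_, _, ⟨?_, ?_, halfStage_of_matching hk hΓ, ?_⟩, ?_⟩
  · have h1 : IsClosed {p : Z × Z' | p.1 ∈ U} := hU.isClopen.isClosed.preimage continuous_fst
    have h2 : IsClosed {p : Z × Z' | p.2 ∈ V} := hV.isClopen.isClosed.preimage continuous_snd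
    exact h1.inter (h2.inter (hΓc.preimage
      (((𝒢.continuous_gate j).comp continuous_fst).prodMk
        ((𝒢'.continuous_gate k).comp continuous_snd))))
  · rintro q ⟨a, b, ha, hab, rfl⟩
    rcases hΓ.sub _ hab with h | h
    · exact absurd h.1 ha
    · obtain ⟨⟨⟨z, hz, hza⟩, -⟩, ⟨⟨z', hz', hzb⟩, hb⟩⟩ := h
      exact ⟨hU.inter_gate ha ⟨z, hz, hza⟩, hV.inter_gate hb ⟨z', hz', hzb⟩⟩
  · convert halfStage_of_matching hj hΓ' using 1
    · ext ⟨z, z'⟩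
      simp only [mem_preimage, mem_ofPred_eq, Prod.swap_prod_mk]
      tauto
    · ext ⟨z, z'⟩
      simp only [mem_preimage, mem_ofPred_eq, Prod.swap_prod_mk, Prod.mk.injEq]
      constructor
      · rintro ⟨a, b, ha, hab, rfl, rfl⟩
        exact ⟨b, a, fun hb => (hΓ.sub _ hab).elim (fun h => ha h.1) fun h => h.2.2 hb,
          hab, rfl, rfl⟩
      · rintro ⟨b, a, hb, hab, rfl, rfl⟩
        exact ⟨a, b, fun ha => (hΓ.sub _ hab).elim (fun h => hb h.2) fun h => h.1.2 ha,
          hab, rfl, rfl⟩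
  · rintro q ⟨a, b, -, -, rfl⟩
    exact ⟨a, fun z hz => hz.2⟩

/-- `E'` and `L'` refine `E` and `L`. -/
def Refines (E' E : Set (Z × Z')) (L' L : Set (Set Z × Set Z')) : Prop :=
  E' ⊆ E ∧ ∀ q ∈ L', ∃ p ∈ L, q.1 ⊆ p.1 ∧ q.2 ⊆ p.2

/-! ### The back-and-forth argument. -/

section uniqueness

variable [Nontrivial κ] [∀ i, CompactSpace (K i)] [∀ i, CompactSpace (K' i)]
    [∀ i, TopologicalSpace.MetrizableSpace (K i)] [∀ i, TopologicalSpace.MetrizableSpace (K' i)]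

/-- On each block the gate of `j` is either constant already, or the block contains the whole piece
`j` and is split along it, against a piece of the same colour in the partner set. -/
theorem Stage.exists_refinement (hiso : ∀ i i', color i = color' i' → Nonempty (X i ≃ₜ X' i'))
    {E : Set (Z × Z')} {L : Set (Set Z × Set Z')} (h : Stage 𝒢 𝒢' univ univ E L) (j : I) :
    ∃ E' L', Stage 𝒢 𝒢' univ univ E' L' ∧ Refines E' E L' L ∧
      ∀ p ∈ L', ∃ a, ∀ z ∈ p.1, 𝒢.gate j z = a := by
  have key : ∀ p : Set Z × Set Z', ∃ EL : Set (Z × Z') × Set (Set Z × Set Z'), p ∈ L →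
      Stage 𝒢 𝒢' p.1 p.2 EL.1 EL.2 ∧ ∀ q ∈ EL.2, ∃ a, ∀ z ∈ q.1, 𝒢.gate j z = a := by
    intro p
    by_cases hp : p ∈ L
    swap
    · exact ⟨(∅, ∅), fun h => absurd h hp⟩
    obtain ⟨hU, hV⟩ := h.good p hp
    rcases hU.dichotomy j with hj | ⟨d, -, hd⟩
    · obtain ⟨k, hk, hkV⟩ := hV.exists_color (color j)
      obtain ⟨φ⟩ := hiso j k hk.symm
      obtain ⟨E', L', hs, hc⟩ := exists_stage hU hV hj hkV φ
      exact ⟨(E', L'), fun _ => ⟨hs, hc⟩⟩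
    · refine ⟨(p.1 ×ˢ p.2, {(p.1, p.2)}), fun _ => ⟨Stage.trivial hU hV, ?_⟩⟩
      rintro q rfl
      exact ⟨d, hd⟩
  choose EL hEL using key
  refine ⟨_, _, h.refine (E' := fun p => (EL p).1) (L' := fun p => (EL p).2)
    fun p hp => (hEL p hp).1, ⟨fun q hq => hq.1, ?_⟩, ?_⟩
  · rintro q ⟨p, hp, hq⟩
    exact ⟨p, hp, (hEL p hp).1.left.sub_block q hq, (hEL p hp).1.right.sub_block q.swap hq⟩
  · rintro q ⟨p, hp, hq⟩
    exact (hEL p hp).2 q hq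

theorem Stage.exists_refinement₂ (hiso : ∀ i i', color i = color' i' → Nonempty (X i ≃ₜ X' i'))
    {E : Set (Z × Z')} {L : Set (Set Z × Set Z')} (h : Stage 𝒢 𝒢' univ univ E L)
    (j : I) (k : I') :
    ∃ E' L', Stage 𝒢 𝒢' univ univ E' L' ∧ E' ⊆ E ∧
      (∀ p ∈ L', ∃ a, ∀ z ∈ p.1, 𝒢.gate j z = a) ∧
      (∀ p ∈ L', ∃ a, ∀ z ∈ p.2, 𝒢'.gate k z = a) := by
  obtain ⟨E₁, L₁, h₁, hr₁, hc₁⟩ := h.exists_refinement hiso j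
  obtain ⟨E₂, L₂, h₂, hr₂, hc₂⟩ := h₁.swap.exists_refinement
    (fun i i' hi => (hiso i' i hi.symm).map Homeomorph.symm) k
  refine ⟨_, _, h₂.swap, ?_, ?_, ?_⟩
  · exact fun p hp => hr₁.1 (hr₂.1 hp)
  -- Constancy of the left gate survives the second refinement because its blocks lie inside those
  -- of the first.
  · intro p hp
    obtain ⟨q, hq, hpq⟩ := hr₂.2 _ hp
    obtain ⟨a, ha⟩ := hc₁ _ hq
    exact ⟨a, fun z hz => ha z (hpq.2 hz)⟩
  · exact fun p hp => hc₂ _ hp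

theorem total_iInter [CompactSpace Z'] {E : ℕ → Set (Z × Z')}
    (hE : ∀ n, IsClosed (E n)) (hmono : ∀ n, E (n + 1) ⊆ E n)
    (htot : ∀ n z, ∃ z', (z, z') ∈ E n) (z : Z) : ∃ z', ∀ n, (z, z') ∈ E n := by
  have := IsCompact.nonempty_iInter_of_sequence_nonempty_isCompact_isClosed
    (fun n => {z' | (z, z') ∈ E n}) (fun n z' hz' => hmono n hz') (fun n => htot n z)
    ((hE 0).preimage (Continuous.prodMk_right z)).isCompact
    (fun n => (hE n).preimage (Continuous.prodMk_right z))
  obtain ⟨z', hz'⟩ := this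
  exact ⟨z', fun n => mem_iInter.1 hz' n⟩

/-- Projecting along a compact factor is a closed map, so preimages of closed sets are closed. -/
theorem continuous_of_isClosed_graph {Z Z' : Type*} [TopologicalSpace Z] [TopologicalSpace Z']
    [CompactSpace Z'] {φ : Z → Z'} (h : IsClosed {p : Z × Z' | φ p.1 = p.2}) :
    Continuous φ := by
  refine continuous_iff_isClosed.2 fun C hC => ?_
  have : φ ⁻¹' C = Prod.fst '' ({p : Z × Z' | φ p.1 = p.2} ∩ Prod.snd ⁻¹' C) := by
    ext z
    simp
  rw [this]
  exact isClosedMap_fst_of_compactSpace _ (h.inter (hC.preimage continuous_snd))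

/-- A closed bijective relation between compact Hausdorff spaces is a homeomorphism. -/
theorem nonempty_homeomorph_of_relation [CompactSpace Z] [CompactSpace Z']
    {E : Set (Z × Z')} (hE : IsClosed E) (h1 : ∀ z, ∃! z', (z, z') ∈ E)
    (h2 : ∀ z', ∃! z, (z, z') ∈ E) : Nonempty (Z ≃ₜ Z') := by
  choose φ hφ hφu using h1
  choose ψ hψ hψu using h2
  refine ⟨⟨⟨φ, ψ, fun z => (hψu _ _ (hφ z)).symm, fun z => (hφu _ _ (hψ z)).symm⟩, ?_, ?_⟩⟩
  · refine continuous_of_isClosed_graph ?_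
    convert hE using 1
    ext ⟨z, z'⟩
    exact ⟨fun h => by rw [← show φ z = z' from h]; exact hφ z, fun h => (hφu _ _ h).symm⟩
  · refine continuous_of_isClosed_graph ?_
    convert hE.preimage continuous_swap using 1
    ext ⟨z, z'⟩
    exact ⟨fun h => by rw [← show ψ z = z' from h]; exact hψ z, fun h => (hψu _ _ h).symm⟩

/-- Compact spaces with gate systems that use the same coloured pieces are homeomorphic. -/
theorem GateSystem.nonempty_homeomorph [CompactSpace Z] [CompactSpace Z']
    [Nonempty Z] [Nonempty Z'] [Countable I] [Countable I']
    (𝒢 : GateSystem Z K X color) (𝒢' : GateSystem Z' K' X' color')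
    (hiso : ∀ i i', color i = color' i' → Nonempty (X i ≃ₜ X' i')) : Nonempty (Z ≃ₜ Z') := by
  obtain ⟨c, -⟩ := exists_pair_ne κ
  obtain ⟨i₀, -⟩ := 𝒢.good_univ.exists_color c
  obtain ⟨i₀', -⟩ := 𝒢'.good_univ.exists_color c
  obtain ⟨u, hu⟩ := @exists_surjective_nat I ⟨i₀⟩ _
  obtain ⟨u', hu'⟩ := @exists_surjective_nat I' ⟨i₀'⟩ _
  -- Step `n` makes the gates of `u n` and `u' n` constant on blocks; both enumerations are
  -- surjective, so every gate is treated.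
  choose! F M hs hsub hc hc' using fun (n : ℕ) (s : Set (Z × Z') × Set (Set Z × Set Z'))
    (h : Stage 𝒢 𝒢' univ univ s.1 s.2) => h.exists_refinement₂ hiso (u n) (u' n)
  let s : ℕ → Set (Z × Z') × Set (Set Z × Set Z') := fun n =>
    Nat.rec (univ ×ˢ univ, {(univ, univ)}) (fun n s => (F n s, M n s)) n
  have hstage : ∀ n, Stage 𝒢 𝒢' univ univ (s n).1 (s n).2 := fun n => by
    induction n with
    | zero => exact Stage.trivial 𝒢.good_univ 𝒢'.good_univ
    | succ n ih => exact hs n _ ih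
  have hmono : ∀ n, (s (n + 1)).1 ⊆ (s n).1 := fun n => hsub n _ (hstage n)
  refine nonempty_homeomorph_of_relation (E := ⋂ n, (s n).1)
    (isClosed_iInter fun n => (hstage n).isClosed) (fun z => ?_) fun z' => ?_
  · obtain ⟨z', hz'⟩ := total_iInter (fun n => (hstage n).isClosed) hmono
      (fun n z => (hstage n).left.total z (mem_univ z)) z
    refine ⟨z', mem_iInter.2 hz', fun z'' hz'' => ?_⟩
    replace hz'' := mem_iInter.1 hz''
    -- Two distinct partners of `z` would share a block at every later stage, so all their gates
    -- would agree.
    by_contra hne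
    refine hne (𝒢'.separating _ _ fun k => ?_)
    obtain ⟨n, rfl⟩ := hu' k
    obtain ⟨p, hp, hzp⟩ :=
      ((hstage (n + 1)).left.func _ _ _ (hz'' (n + 1)) (hz' (n + 1))).resolve_left hne
    obtain ⟨a, ha⟩ := hc' n _ (hstage n) p hp
    rw [ha _ (((hstage (n + 1)).left.block p hp z hzp _).1 (hz'' (n + 1))),
      ha _ (((hstage (n + 1)).left.block p hp z hzp _).1 (hz' (n + 1)))]
  · obtain ⟨z, hz⟩ := total_iInter (E := fun n => Prod.swap ⁻¹' (s n).1)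
      (fun n => (hstage n).swap.isClosed) (fun n p hp => hmono n hp)
      (fun n z => (hstage n).right.total z (mem_univ z)) z'
    refine ⟨z, mem_iInter.2 hz, fun y hy => ?_⟩
    replace hy := mem_iInter.1 hy
    by_contra hne
    refine hne (𝒢.separating _ _ fun k => ?_)
    obtain ⟨n, rfl⟩ := hu k
    obtain ⟨p, hp, hzp⟩ :=
      ((hstage (n + 1)).right.func _ _ _ (hy (n + 1)) (hz (n + 1))).resolve_left hne
    obtain ⟨a, ha⟩ := hc n _ (hstage n) p.swap hp
    rw [ha _ (((hstage (n + 1)).right.block p hp z' hzp _).1 (hy (n + 1))),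
      ha _ (((hstage (n + 1)).right.block p hp z' hzp _).1 (hz (n + 1)))]

end uniqueness

end Floyd

/-! ### First syllables in free products. -/

namespace Floyd

open Monoid

/-- The projections `π i` of a free product `G` to its factors: `π i g` is the first syllable of
`g` if it lies in the factor `H i`, and `1` otherwise. -/
structure FreeProjections {ι : Type*} {H : ι → Type*} [∀ i, Group (H i)] {G : Type*} [Group G]
    (of : ∀ i, H i →* G) (π : ∀ i, G → H i) : Prop where
  proj_of_mul : ∀ i a g, π i (of i a * g) = a * π i g
  proj_one : ∀ i, π i 1 = 1
  proj_mul_of : ∀ i j (b : H j) g, π i (g * of j b) = π i g ∨ (i = j ∧ g ∈ (of i).range)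
  proj_eq_one : ∀ i l g, i ≠ l → π l g ≠ 1 → π i g = 1
  eq_one : ∀ g, (∀ i, π i g = 1) → g = 1
  closure_eq : Subgroup.closure (⋃ i, Set.range (of i)) = ⊤

section words

variable {ι : Type*} {H : ι → Type*} [∀ i, Group (H i)] [DecidableEq ι] [∀ i, DecidableEq (H i)]

/-- The first syllable of `g` in the factor `H i`. -/
def firstSyllable (i : ι) (g : CoprodI H) : H i :=
  (CoprodI.Word.equivPair i (g • CoprodI.Word.empty)).head

theorem firstSyllable_of_mul (i : ι) (a : H i) (g : CoprodI H) :
    firstSyllable i (CoprodI.of a * g) = a * firstSyllable i g := by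
  rw [firstSyllable, mul_smul, CoprodI.Word.equivPair_smul_same]
  rfl

theorem firstSyllable_one (i : ι) : firstSyllable i (1 : CoprodI H) = 1 := by
  rw [firstSyllable, one_smul, CoprodI.Word.equivPair_eq_of_fstIdx_ne]
  simp [CoprodI.Word.fstIdx, CoprodI.Word.empty]

theorem firstSyllable_of (i : ι) (a : H i) : firstSyllable i (CoprodI.of a) = a := by
  simpa [firstSyllable_one] using firstSyllable_of_mul i a 1

theorem firstSyllable_eq_one {i l : ι} {g : CoprodI H} (hil : i ≠ l)
    (h : firstSyllable l g ≠ 1) : firstSyllable i g = 1 := by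
  have hl : CoprodI.Word.fstIdx (g • (CoprodI.Word.empty : CoprodI.Word H)) = some l := by
    by_contra hne
    exact h (by rw [firstSyllable, CoprodI.Word.equivPair_eq_of_fstIdx_ne hne])
  rw [firstSyllable, CoprodI.Word.equivPair_eq_of_fstIdx_ne]
  rw [hl]
  simpa using hil.symm

theorem firstSyllable_induction {motive : CoprodI H → Prop} (one : motive 1)
    (mul : ∀ i (m : H i) (g : CoprodI H), m ≠ 1 → firstSyllable i g = 1 → motive g →
      motive (CoprodI.of m * g)) (g : CoprodI H) : motive g := by
  have key : ∀ w : CoprodI.Word H, motive w.prod := by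
    intro w
    induction w using CoprodI.Word.consRecOn with
    | empty => simpa using one
    | cons i m w h1 h2 ih =>
      rw [CoprodI.Word.prod_cons]
      refine mul i m _ h2 ?_ ih
      rw [firstSyllable, show w.prod • CoprodI.Word.empty = w from
        CoprodI.Word.equiv.right_inv w, CoprodI.Word.equivPair_eq_of_fstIdx_ne h1]
  have := key (g • CoprodI.Word.empty)
  rwa [CoprodI.Word.prod_smul, CoprodI.Word.prod_empty, mul_one] at this

theorem eq_one_of_firstSyllable {g : CoprodI H} (h : ∀ i, firstSyllable i g = 1) : g = 1 := by
  induction g using firstSyllable_induction with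
  | one => rfl
  | mul i m g hm hg _ =>
    have := h i
    rw [firstSyllable_of_mul, hg, mul_one] at this
    exact absurd this hm

/-- A letter multiplied on the right affects only the end of the reduced word. It reaches the first
syllable in `H i` only if it belongs to `H i` and the word has no syllable outside `H i`. -/
theorem firstSyllable_mul_of (i j : ι) (b : H j) (g : CoprodI H) :
    firstSyllable i (g * CoprodI.of b) = firstSyllable i g ∨
      (i = j ∧ g ∈ (CoprodI.of : H i →* CoprodI H).range) := by
  induction g using firstSyllable_induction generalizing i with
  | one =>
    by_cases hij : i = j
    · exact Or.inr ⟨hij, one_mem _⟩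
    left
    rw [one_mul, firstSyllable_one]
    by_cases hb : b = 1
    · rw [hb, map_one, firstSyllable_one]
    · exact firstSyllable_eq_one hij (by rwa [firstSyllable_of])
  | mul l m g hm hg ih =>
    by_cases hil : i = l
    · subst hil
      rw [mul_assoc, firstSyllable_of_mul, firstSyllable_of_mul]
      rcases ih i with h | ⟨h, h'⟩
      · exact Or.inl (by rw [h])
      · exact Or.inr ⟨h, mul_mem ⟨m, rfl⟩ h'⟩
    left
    have h1 : firstSyllable i (CoprodI.of m * g) = 1 :=
      firstSyllable_eq_one hil (by rwa [firstSyllable_of_mul, hg, mul_one])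
    rw [h1]
    rcases ih l with h | ⟨rfl, x, rfl⟩
    · exact firstSyllable_eq_one hil
        (by rwa [mul_assoc, firstSyllable_of_mul, h, hg, mul_one])
    · rw [← map_mul, ← map_mul]
      by_cases hone : m * x * b = 1
      · rw [hone, map_one, firstSyllable_one]
      · exact firstSyllable_eq_one hil (by rwa [firstSyllable_of])

end words

section

variable {ι : Type*} {H : ι → Type*} [∀ i, Group (H i)] {G : Type*} [Group G]
  {of : ∀ i, H i →* G}

theorem exists_freeProjections (hof : Function.Bijective (CoprodI.lift of)) :
    ∃ π : ∀ i, G → H i, FreeProjections of π := by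
  classical
  let φ : CoprodI H ≃* G := MulEquiv.ofBijective _ hof
  have hφ : ∀ i (a : H i), φ.symm (of i a) = CoprodI.of a := fun i a => by
    rw [MulEquiv.symm_apply_eq]
    exact (CoprodI.lift_of of a).symm
  have hφ' : ∀ i (a : H i), φ (CoprodI.of a) = of i a := fun i a => CoprodI.lift_of of a
  refine ⟨fun i g => firstSyllable i (φ.symm g), ⟨fun i a g => ?_, fun i => ?_, fun i j b g => ?_,
    fun i l g => firstSyllable_eq_one, fun g hg => ?_, ?_⟩⟩
  · rw [map_mul, hφ, firstSyllable_of_mul]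
  · rw [map_one, firstSyllable_one]
  · rw [map_mul, hφ]
    refine (firstSyllable_mul_of i j b (φ.symm g)).imp_right (And.imp_right ?_)
    rintro ⟨x, hx⟩
    exact ⟨x, by rw [← hφ', hx, MulEquiv.apply_symm_apply]⟩
  · simpa using eq_one_of_firstSyllable hg
  · rw [Subgroup.closure_iUnion]
    simp only [← MonoidHom.coe_range, Subgroup.closure_eq]
    rw [← CoprodI.range_eq_iSup, MonoidHom.range_eq_top]
    exact hof.2

variable {π : ∀ i, G → H i}

namespace FreeProjections

variable (h : FreeProjections of π)

include h

theorem proj_of (i : ι) (a : H i) : π i (of i a) = a := by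
  simpa [h.proj_one] using h.proj_of_mul i a 1

theorem injective_of (i : ι) : Function.Injective (of i) :=
  Function.LeftInverse.injective (h.proj_of i)

/-- Any point of `w * H i` is one letter away from `w`, and such a letter moves the gate in `v * H
l` only if the two cosets coincide. -/
theorem proj_mul_of_const {i l : ι} {w v : G} (hne : ¬(i = l ∧ w⁻¹ * v ∈ (of i).range))
    {g : G} (hg : w⁻¹ * g ∈ (of i).range) : π l (v⁻¹ * g) = π l (v⁻¹ * w) := by
  obtain ⟨y, hy⟩ := hg
  have : v⁻¹ * g = v⁻¹ * w * of i y := by rw [hy]; group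
  rw [this]
  refine (h.proj_mul_of l i y _).resolve_right ?_
  rintro ⟨rfl, hr⟩
  refine hne ⟨rfl, ?_⟩
  simpa using inv_mem hr

/-- Two distinct cosets of factors are separated by their gates. -/
theorem tree {i l : ι} {w v : G} (hne : ¬(i = l ∧ w⁻¹ * v ∈ (of i).range)) (g : G) :
    π l (v⁻¹ * g) = π l (v⁻¹ * w) ∨ π i (w⁻¹ * g) = π i (w⁻¹ * v) := by
  have hne' : ¬(l = i ∧ v⁻¹ * w ∈ (of l).range) := by
    rintro ⟨rfl, hr⟩
    exact hne ⟨rfl, by simpa using inv_mem hr⟩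
  -- The disjunction survives each letter: one gate can change only while the path is inside its own
  -- coset, and there the other gate has its constant value.
  have step : ∀ x m (b : H m), (π l (v⁻¹ * x) = π l (v⁻¹ * w) ∨ π i (w⁻¹ * x) = π i (w⁻¹ * v)) →
      (π l (v⁻¹ * (x * of m b)) = π l (v⁻¹ * w) ∨ π i (w⁻¹ * (x * of m b)) = π i (w⁻¹ * v)) := by
    intro x m b hx
    rcases h.proj_mul_of l m b (v⁻¹ * x) with h1 | ⟨rfl, h1⟩
    swap
    · right
      refine h.proj_mul_of_const hne' ?_
      rw [← mul_assoc]
      exact mul_mem h1 ⟨b, rfl⟩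
    rcases h.proj_mul_of i m b (w⁻¹ * x) with h2 | ⟨rfl, h2⟩
    swap
    · left
      refine h.proj_mul_of_const hne ?_
      rw [← mul_assoc]
      exact mul_mem h2 ⟨b, rfl⟩
    rwa [← mul_assoc, ← mul_assoc, h1, h2]
  have key : ∀ y, π l (v⁻¹ * (w * y)) = π l (v⁻¹ * w) ∨ π i (w⁻¹ * (w * y)) = π i (w⁻¹ * v) := by
    intro y
    have hy : y ∈ Subgroup.closure (⋃ i, Set.range (of i)) := h.closure_eq ▸ Subgroup.mem_top y
    induction hy using Subgroup.closure_induction_right with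
    | one => left; rw [mul_one]
    | mul_right x _ y hy ih =>
      obtain ⟨m, b, rfl⟩ := Set.mem_iUnion.1 hy
      rw [← mul_assoc w]
      exact step _ m b ih
    | mul_inv_cancel x _ y hy ih =>
      obtain ⟨m, b, rfl⟩ := Set.mem_iUnion.1 hy
      rw [← mul_assoc w, ← map_inv]
      exact step _ m b⁻¹ ih
  simpa using key (w⁻¹ * g)

end FreeProjections

end

end Floyd

/-! ### Floyd functions and Floyd lengths in Cayley graphs. -/

namespace Floyd

open Topology Filter Set
open scoped NNReal

namespace IsFloydFunction

variable {f : ℕ → ℝ} (hf : IsFloydFunction f)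

include hf

theorem antitone : Antitone f := by
  obtain ⟨c, -, hc⟩ := hf.decay
  refine antitone_nat_of_succ_le fun n => ?_
  rcases Nat.eq_zero_or_pos n with rfl | hn
  · exact hf.zero.ge
  · exact (hc n hn).1

theorem pos' (n : ℕ) : 0 < f n := by
  rcases Nat.eq_zero_or_pos n with rfl | hn
  · rw [hf.zero]; exact hf.pos 1 le_rfl
  · exact hf.pos n hn

/-- Iterating the lower decay bound gives the constant `c⁻ᵏ`. It absorbs the bounded change of word
length under translation by a fixed element. -/
theorem exists_shift (k : ℕ) : ∃ C : ℝ≥0, C ≠ 0 ∧ ∀ n m, n ≤ m + k → f m ≤ C * f n := by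
  obtain ⟨c, hc0, hc⟩ := hf.decay
  -- Needed for the decay bound at `0`, where `f 0 = f 1`.
  have hc1 : c ≤ 1 := by
    have h := (hc 1 le_rfl).2.trans (hc 1 le_rfl).1
    have h1 := hf.pos 1 le_rfl
    by_contra! hlt
    nlinarith
  have hstep : ∀ m, c * f m ≤ f (m + 1) := fun m => by
    rcases Nat.eq_zero_or_pos m with rfl | hm
    · rw [hf.zero, zero_add]
      nlinarith [hf.pos' 1]
    · exact (hc m hm).2
  have hpow : ∀ k m, c ^ k * f m ≤ f (m + k) := fun k m => by
    induction k with
    | zero => simp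
    | succ k ih =>
      calc c ^ (k + 1) * f m = c * (c ^ k * f m) := by ring
        _ ≤ c * f (m + k) := by gcongr
        _ ≤ _ := hstep _
  refine ⟨⟨(c ^ k)⁻¹, by positivity⟩, ?_, fun n m hnm => ?_⟩
  · exact fun h => inv_ne_zero (pow_ne_zero _ hc0.ne') (congrArg NNReal.toReal h)
  · change f m ≤ (c ^ k)⁻¹ * f n
    rw [le_inv_mul_iff₀ (by positivity)]
    exact (hpow k m).trans (hf.antitone hnm)

end IsFloydFunction

/-- The tail sums of the series `∑ f n`. -/
noncomputable def tailSum (f : ℕ → ℝ) (n : ℕ) : ℝ := ∑' k, f (k + n)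

section tailSum

variable {f : ℕ → ℝ} (hf : IsFloydFunction f)

include hf

theorem tailSum_nonneg (n : ℕ) : 0 ≤ tailSum f n := tsum_nonneg fun _ => (hf.pos' _).le

theorem sum_le_tailSum (n N : ℕ) : ∑ k ∈ Finset.range N, f (k + n) ≤ tailSum f n :=
  ((summable_nat_add_iff n).2 hf.summable).sum_le_tsum _ fun _ _ => (hf.pos' _).le

theorem tailSum_antitone : Antitone (tailSum f) := fun m n hmn =>
  ((summable_nat_add_iff n).2 hf.summable).tsum_le_tsum
    (fun k => hf.antitone (by lia)) ((summable_nat_add_iff m).2 hf.summable)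

omit hf in
theorem tendsto_tailSum : Tendsto (tailSum f) atTop (𝓝 0) := tendsto_sum_nat_add f

end tailSum

section graph

variable {G : Type*} [Group G] {S : Set G}

theorem connected_mulCayley (hS : Subgroup.closure S = ⊤) :
    (SimpleGraph.mulCayley S).Connected := by
  have hadj : ∀ g, ∀ s ∈ S, (SimpleGraph.mulCayley S).Reachable g (g * s) := fun g s hs => by
    by_cases h : g = g * s
    · rw [← h]
    · exact ((SimpleGraph.mulCayley_adj' S _ _).2 ⟨h, s, hs, Or.inl rfl⟩).reachable
  have key : ∀ g, (SimpleGraph.mulCayley S).Reachable 1 g := fun g => by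
    have hg : g ∈ Subgroup.closure S := hS ▸ Subgroup.mem_top g
    induction hg using Subgroup.closure_induction_right with
    | one => rfl
    | mul_right x _ y hy ih => exact ih.trans (hadj x y hy)
    | mul_inv_cancel x _ y hy ih =>
      exact ih.trans (by simpa using (hadj (x * y⁻¹) y hy).symm)
  exact (SimpleGraph.connected_iff _).2 ⟨fun u v => (key u).symm.trans (key v), ⟨1⟩⟩

theorem wordLength_one : wordLength S (1 : G) = 0 := SimpleGraph.dist_self

theorem wordLength_adj (hS : Subgroup.closure S = ⊤) {v w : G}
    (h : (SimpleGraph.mulCayley S).Adj v w) : wordLength S w ≤ wordLength S v + 1 := by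
  have := (connected_mulCayley hS).dist_triangle (u := 1) (v := v) (w := w)
  rwa [SimpleGraph.dist_eq_one_iff_adj.2 h] at this

theorem dist_mul_left (hS : Subgroup.closure S = ⊤) (d u v : G) :
    (SimpleGraph.mulCayley S).dist (d * u) (d * v) = (SimpleGraph.mulCayley S).dist u v := by
  have key : ∀ d u v : G,
      (SimpleGraph.mulCayley S).dist (d * u) (d * v) ≤ (SimpleGraph.mulCayley S).dist u v := by
    intro d u v
    obtain ⟨p, hp⟩ := (connected_mulCayley hS).exists_walk_length_eq_dist u v
    let φ : SimpleGraph.mulCayley S →g SimpleGraph.mulCayley S :=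
      ⟨fun x => d * x, fun h => SimpleGraph.mulCayley_adj_mul_iff_right.2 h⟩
    rw [← hp, ← SimpleGraph.Walk.length_map φ p]
    exact SimpleGraph.dist_le (p.map φ)
  refine le_antisymm (key d u v) ?_
  simpa using key d⁻¹ (d * u) (d * v)

theorem wordLength_le_add_mul (hS : Subgroup.closure S = ⊤) (w g : G) :
    wordLength S g ≤ wordLength S w + wordLength S (w * g) := by
  have h := (connected_mulCayley hS).dist_triangle (u := w) (v := 1) (w := w * g)
  have h' := dist_mul_left hS w 1 g
  rw [mul_one] at h'
  rw [h', SimpleGraph.dist_comm (u := w)] at h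
  exact h

theorem exists_pred (hS : Subgroup.closure S = ⊤) {g : G} {n : ℕ} (h : wordLength S g = n + 1) :
    ∃ g', (SimpleGraph.mulCayley S).Adj g' g ∧ wordLength S g' ≤ n := by
  obtain ⟨p, hp⟩ := (connected_mulCayley hS).exists_walk_length_eq_dist g 1
  rw [SimpleGraph.dist_comm] at hp
  change p.length = wordLength S g at hp
  rw [h] at hp
  cases p with
  | nil => simp at hp
  | cons hadj q =>
    refine ⟨_, hadj.symm, ?_⟩
    rw [SimpleGraph.Walk.length_cons] at hp
    have := SimpleGraph.dist_le q.reverse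
    rw [SimpleGraph.Walk.length_reverse] at this
    exact this.trans (by lia)

theorem finite_ball (hS : Subgroup.closure S = ⊤) (hfin : S.Finite) (n : ℕ) :
    {g : G | wordLength S g ≤ n}.Finite := by
  induction n with
  | zero =>
    refine (Set.finite_singleton (1 : G)).subset fun g hg => ?_
    have : (SimpleGraph.mulCayley S).dist 1 g = 0 := Nat.le_zero.1 hg
    exact ((connected_mulCayley hS).dist_eq_zero_iff.1 this).symm
  | succ n ih =>
    refine (ih.union (ih.image2 (· * ·) (hfin.union hfin.inv))).subset fun g hg => ?_
    rcases Nat.lt_or_ge n (wordLength S g) with h | h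
    · obtain ⟨g', hadj, hg'⟩ := exists_pred hS (le_antisymm hg h)
      refine Or.inr ⟨g', hg', g'⁻¹ * g, ?_, by group⟩
      rcases ((SimpleGraph.mulCayley_adj S _ _).1 hadj).2 with h | h
      · exact Or.inl h
      · exact Or.inr (by simpa using h)
    · exact Or.inl h

theorem countable_of_closure (hS : Subgroup.closure S = ⊤) (hfin : S.Finite) : Countable G := by
  rw [← Set.countable_univ_iff]
  have : (univ : Set G) = ⋃ n, {g : G | wordLength S g ≤ n} :=
    (eq_univ_of_forall fun g => mem_iUnion.2 ⟨wordLength S g, le_refl (wordLength S g)⟩).symm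
  rw [this]
  exact countable_iUnion fun n => (finite_ball hS hfin n).countable

variable {f : ℕ → ℝ}

theorem floydLength_cons {u v w : G} (h : (SimpleGraph.mulCayley S).Adj u v)
    (p : (SimpleGraph.mulCayley S).Walk v w) : floydLength f S (.cons h p) =
      f (min (wordLength S u) (wordLength S v)) + floydLength f S p := by
  simp [floydLength]

theorem floydLength_nil (u : G) :
    floydLength f S (.nil : (SimpleGraph.mulCayley S).Walk u u) = 0 := by
  simp [floydLength]

theorem floydLength_nonneg (hf : IsFloydFunction f) {v w : G}
    (p : (SimpleGraph.mulCayley S).Walk v w) : 0 ≤ floydLength f S p := by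
  refine List.sum_nonneg fun x hx => ?_
  obtain ⟨e, -, rfl⟩ := List.mem_map.1 hx
  exact (hf.pos' _).le

theorem floydEDist_le (v w : G) (p : (SimpleGraph.mulCayley S).Walk v w) :
    floydEDist f S v w ≤ ENNReal.ofReal (floydLength f S p) := iInf_le _ p

theorem floydEDist_le_of_adj {v w : G} (h : (SimpleGraph.mulCayley S).Adj v w) :
    floydEDist f S v w ≤ ENNReal.ofReal (f (min (wordLength S v) (wordLength S w))) := by
  refine (floydEDist_le v w (.cons h .nil)).trans ?_
  rw [floydLength_cons, floydLength_nil, add_zero]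

theorem floydEDist_ne_top (hS : Subgroup.closure S = ⊤) (v w : G) : floydEDist f S v w ≠ ⊤ := by
  obtain ⟨p⟩ := (connected_mulCayley hS).preconnected v w
  exact ne_top_of_le_ne_top ENNReal.ofReal_ne_top (floydEDist_le v w p)

/-- The first edge of a path leaving `v` already costs at least `f (wordLength S v)`. -/
theorem eq_of_floydEDist_lt (hf : IsFloydFunction f) {v w : G}
    (h : floydEDist f S v w < ENNReal.ofReal (f (wordLength S v))) : v = w := by
  obtain ⟨p, hp⟩ := iInf_lt_iff.1 h
  cases p with
  | nil => rfl
  | @cons _ u _ hadj q =>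
    rw [floydLength_cons] at hp
    refine absurd hp (not_lt.2 (ENNReal.ofReal_le_ofReal ?_))
    have := floydLength_nonneg hf q
    have := hf.antitone (min_le_left (wordLength S v) (wordLength S u))
    linarith

/-- Lipschitz bounds need checking only on edges. The condition `C ≠ 0` lets the factor pass through
the infimum in `ℝ≥0∞`. -/
theorem floydEDist_map_le {G' : Type*} [Group G'] {S' : Set G'} {f' : ℕ → ℝ}
    (hf : IsFloydFunction f) {C : ℝ≥0} (hC : C ≠ 0) (φ : G → G')
    (h : ∀ v w, (SimpleGraph.mulCayley S).Adj v w → floydEDist f' S' (φ v) (φ w) ≤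
      C * ENNReal.ofReal (f (min (wordLength S v) (wordLength S w)))) (v w : G) :
    floydEDist f' S' (φ v) (φ w) ≤ C * floydEDist f S v w := by
  rw [floydEDist.eq_def f S, ENNReal.mul_iInf_of_ne (by simpa using hC) ENNReal.coe_ne_top]
  refine le_iInf fun p => ?_
  induction p with
  | nil => rw [floydEDist_self]; exact bot_le
  | cons hadj q ih =>
    rw [floydLength_cons, ENNReal.ofReal_add (hf.pos' _).le (floydLength_nonneg hf q), mul_add]
    exact (floydEDist_triangle _ _ _ _ _).trans (add_le_add (h _ _ hadj) ih)

/-- The hypothesis makes `p` lead straight away from `1`, so word length rises by one along each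
edge. -/
theorem floydLength_eq_sum (hS : Subgroup.closure S = ⊤) {x g : G}
    (p : (SimpleGraph.mulCayley S).Walk x g)
    (hp : wordLength S g = wordLength S x + p.length) :
    floydLength f S p = ∑ k ∈ Finset.range p.length, f (k + wordLength S x) := by
  induction p with
  | nil => simp [floydLength_nil]
  | @cons x y g hadj q ih =>
    rw [SimpleGraph.Walk.length_cons] at hp ⊢
    have h1 := wordLength_adj hS hadj
    have h2 : wordLength S g ≤ wordLength S y + q.length :=
      (connected_mulCayley hS).dist_triangle.trans
        (Nat.add_le_add_left (SimpleGraph.dist_le q) _)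
    have h3 : wordLength S y = wordLength S x + 1 := by lia
    rw [floydLength_cons, ih (by lia), Finset.sum_range_succ', h3, min_eq_left (by lia), zero_add,
      add_comm]
    congr 1
    refine Finset.sum_congr rfl fun k _ => ?_
    congr 1
    lia

theorem floydEDist_le_tailSum (hf : IsFloydFunction f) (hS : Subgroup.closure S = ⊤) {x g : G}
    (h : wordLength S g = wordLength S x + (SimpleGraph.mulCayley S).dist x g) :
    floydEDist f S x g ≤ ENNReal.ofReal (tailSum f (wordLength S x)) := by
  obtain ⟨p, hp⟩ := (connected_mulCayley hS).exists_walk_length_eq_dist x g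
  refine (floydEDist_le _ _ p).trans (ENNReal.ofReal_le_ofReal ?_)
  rw [floydLength_eq_sum hS _ (by lia)]
  exact sum_le_tailSum hf _ _

/-- A point that every path from `u` to `g` passes through lies on a geodesic. -/
theorem dist_eq_add_dist (hS : Subgroup.closure S = ⊤) {u x g : G}
    (h : ∀ p : (SimpleGraph.mulCayley S).Walk u g, x ∈ p.support) :
    (SimpleGraph.mulCayley S).dist u g =
      (SimpleGraph.mulCayley S).dist u x + (SimpleGraph.mulCayley S).dist x g := by
  classical
  obtain ⟨p, hp⟩ := (connected_mulCayley hS).exists_walk_length_eq_dist u g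
  have hx := h p
  have hlen : (p.takeUntil x hx).length + (p.dropUntil x hx).length = p.length := by
    rw [← SimpleGraph.Walk.length_append, SimpleGraph.Walk.take_spec]
  have h1 := SimpleGraph.dist_le (p.takeUntil x hx)
  have h2 := SimpleGraph.dist_le (p.dropUntil x hx)
  have h3 := (connected_mulCayley hS).dist_triangle (u := u) (v := x) (w := g)
  lia

theorem wordLength_eq_add_dist (hS : Subgroup.closure S = ⊤) {x g : G}
    (h : ∀ p : (SimpleGraph.mulCayley S).Walk 1 g, x ∈ p.support) :
    wordLength S g = wordLength S x + (SimpleGraph.mulCayley S).dist x g :=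
  dist_eq_add_dist hS h

theorem wordLength_mul_le (hS : Subgroup.closure S = ⊤) (w g : G) :
    wordLength S (w * g) ≤ wordLength S w + wordLength S g := by
  have h1 := wordLength_le_add_mul hS w⁻¹ (w * g)
  have h2 := wordLength_le_add_mul hS w w⁻¹
  rw [inv_mul_cancel_left] at h1
  rw [mul_inv_cancel, wordLength_one] at h2
  lia

theorem exists_geodesic_point (hS : Subgroup.closure S = ⊤) {g : G} {n : ℕ}
    (h : n ≤ wordLength S g) : ∃ x, wordLength S x = n ∧
      wordLength S g = wordLength S x + (SimpleGraph.mulCayley S).dist x g := by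
  obtain ⟨k, hk⟩ := Nat.exists_eq_add_of_le h
  have key : ∀ k g, wordLength S g = n + k →
      ∃ x, wordLength S x = n ∧ (SimpleGraph.mulCayley S).dist x g ≤ k := by
    intro k
    induction k with
    | zero => exact fun g hg => ⟨g, hg, by simp⟩
    | succ k ih =>
      intro g hg
      obtain ⟨g', hadj, hg'⟩ := exists_pred (n := n + k) hS hg
      have := wordLength_adj hS hadj
      obtain ⟨x, hx, hd⟩ := ih g' (by lia)
      refine ⟨x, hx, ?_⟩
      have := (connected_mulCayley hS).dist_triangle (u := x) (v := g') (w := g)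
      rw [SimpleGraph.dist_eq_one_iff_adj.2 hadj] at this
      lia
  obtain ⟨x, hx, hd⟩ := key k g hk
  have h3 : wordLength S g ≤ wordLength S x + (SimpleGraph.mulCayley S).dist x g :=
    (connected_mulCayley hS).dist_triangle
  exact ⟨x, hx, by lia⟩

end graph

/-! ### The Floyd completion and its boundary. -/

section completion

open UniformSpace

variable {G : Type*} [Group G] {S : Set G} {f : ℕ → ℝ}

theorem uniformContinuous_of_floydEDist_le {G' : Type*} [Group G'] {S' : Set G'} {f' : ℕ → ℝ}
    {φ : FloydGraph f S → FloydGraph f' S'} {C : ℝ≥0}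
    (h : ∀ v w, floydEDist f' S' (φ v) (φ w) ≤ C * floydEDist f S v w) : UniformContinuous φ :=
  LipschitzWith.uniformContinuous (K := C) h

/-- The metric on the Floyd completion. -/
@[reducible]
noncomputable def completionMetric (f : ℕ → ℝ) (hS : Subgroup.closure S = ⊤) :
    MetricSpace (FloydCompletion f S) :=
  @Completion.instMetricSpace (FloydGraph f S)
    (PseudoEMetricSpace.toPseudoMetricSpace fun v w => floydEDist_ne_top hS v w)

theorem dist_coe (hS : Subgroup.closure S = ⊤) (v w : FloydGraph f S) :
    (completionMetric f hS).dist v w = (floydEDist f S v w).toReal :=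
  @Completion.dist_eq (FloydGraph f S)
    (PseudoEMetricSpace.toPseudoMetricSpace fun v w => floydEDist_ne_top hS v w) v w

theorem dist_coe_le (hS : Subgroup.closure S = ⊤) {v w : FloydGraph f S} {t : ℝ} (ht : 0 ≤ t)
    (h : floydEDist f S v w ≤ ENNReal.ofReal t) : (completionMetric f hS).dist v w ≤ t := by
  rw [dist_coe]
  exact ENNReal.toReal_le_of_le_ofReal ht h

theorem metrizableSpace_completion (f : ℕ → ℝ) (hS : Subgroup.closure S = ⊤) :
    TopologicalSpace.MetrizableSpace (FloydCompletion f S) := by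
  let _ := completionMetric f hS
  infer_instance

theorem isOpen_singleton_vertex (hf : IsFloydFunction f) (v : FloydGraph f S) :
    IsOpen {v} := by
  have : Metric.eball v (ENNReal.ofReal (f (wordLength S v))) = {v} := by
    ext w
    refine ⟨fun h => (eq_of_floydEDist_lt hf (Metric.mem_eball'.1 h)).symm, ?_⟩
    rintro rfl
    exact Metric.mem_eball_self (ENNReal.ofReal_pos.2 (hf.pos' _))
  rw [← this]
  exact Metric.isOpen_eball

/-- An open set whose trace on the dense image is one point lies in the closure of that point. -/
theorem isOpen_singleton_coe (hf : IsFloydFunction f) (v : FloydGraph f S) :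
    IsOpen {(v : FloydCompletion f S)} := by
  obtain ⟨O, hO, hOv⟩ := (Completion.isDenseInducing_coe (α := FloydGraph f S)).isOpen_iff.1
    (isOpen_singleton_vertex hf v)
  convert hO
  refine subset_antisymm ?_ ?_
  · rintro _ rfl
    exact show v ∈ _ ⁻¹' O from hOv ▸ rfl
  · have h := Completion.denseRange_coe.open_subset_closure_inter hO
    have h' : O ∩ range ((↑) : FloydGraph f S → FloydCompletion f S) = {(v : FloydCompletion f S)} := by
      ext x
      constructor
      · rintro ⟨hx, w, rfl⟩
        have hw : w ∈ ((↑) : FloydGraph f S → FloydCompletion f S) ⁻¹' O := hx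
        rw [hOv] at hw
        rw [mem_singleton_iff.1 hw]
        rfl
      · rintro rfl
        exact ⟨show v ∈ _ ⁻¹' O from hOv ▸ rfl, v, rfl⟩
    rwa [h', closure_singleton] at h

theorem coe_injective_of_isFloydFunction (hf : IsFloydFunction f) :
    Function.Injective ((↑) : FloydGraph f S → FloydCompletion f S) := by
  intro v w h
  have hins : Inseparable v w :=
    (Completion.isDenseInducing_coe (α := FloydGraph f S)).isInducing.inseparable_iff.1
      (Inseparable.of_eq h)
  exact ((hins.mem_open_iff (isOpen_singleton_vertex hf v)).1 rfl).symm

/-- Balls of the word metric are finite, and cutting a geodesic at length `n` shows that the ball of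
radius `n` is within `tailSum f n` of every vertex. -/
theorem compactSpace_completion (hf : IsFloydFunction f) (hS : Subgroup.closure S = ⊤)
    (hfin : S.Finite) : CompactSpace (FloydCompletion f S) := by
  have htb : TotallyBounded (univ : Set (FloydGraph f S)) := by
    refine EMetric.totallyBounded_iff.2 fun ε hε => ?_
    have hlim := ENNReal.tendsto_ofReal (tendsto_tailSum (f := f))
    rw [ENNReal.ofReal_zero] at hlim
    obtain ⟨n, hn⟩ := (hlim.eventually_lt_const hε).exists
    refine ⟨{g : G | wordLength S g ≤ n}, finite_ball hS hfin n, fun g _ => ?_⟩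
    rcases le_total (wordLength S g) n with h | h
    · exact mem_biUnion (x := g) h (Metric.mem_eball_self hε)
    · obtain ⟨x, hx, hxg⟩ := exists_geodesic_point hS h
      refine mem_biUnion (x := x) hx.le ?_
      refine Metric.mem_eball'.2 (lt_of_le_of_lt (floydEDist_le_tailSum hf hS hxg) ?_)
      rwa [hx]
  have h1 := (htb.image (Completion.uniformContinuous_coe (FloydGraph f S))).closure
  rw [image_univ, Completion.denseRange_coe.closure_range] at h1
  exact ⟨h1.isCompact_of_isClosed isClosed_univ⟩

theorem isOpen_range_coe (hf : IsFloydFunction f) :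
    IsOpen (range ((↑) : FloydGraph f S → FloydCompletion f S)) := by
  rw [← iUnion_singleton_eq_range]
  exact isOpen_iUnion fun v => isOpen_singleton_coe hf v

theorem compactSpace_boundary (hf : IsFloydFunction f) (hS : Subgroup.closure S = ⊤)
    (hfin : S.Finite) : CompactSpace (FloydBoundary f S) := by
  have := compactSpace_completion hf hS hfin
  exact isCompact_iff_compactSpace.1 (isOpen_range_coe hf).isClosed_compl.isCompact

/-- Without boundary points the completion would be compact and discrete, hence finite. -/
theorem nonempty_boundary [Infinite G] (hf : IsFloydFunction f) (hS : Subgroup.closure S = ⊤)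
    (hfin : S.Finite) : (range ((↑) : FloydGraph f S → FloydCompletion f S))ᶜ.Nonempty := by
  have := compactSpace_completion hf hS hfin
  by_contra hne
  rw [not_nonempty_iff_eq_empty, compl_empty_iff] at hne
  have hd : DiscreteTopology (FloydCompletion f S) := by
    refine discreteTopology_iff_isOpen_singleton.2 fun x => ?_
    obtain ⟨v, rfl⟩ : x ∈ range _ := hne ▸ mem_univ x
    exact isOpen_singleton_coe hf v
  have hfin' := finite_of_compact_of_discrete (X := FloydCompletion f S)
  exact not_finite_iff_infinite.2 (inferInstanceAs (Infinite G))
    (Finite.of_injective _ (coe_injective_of_isFloydFunction (S := S) hf))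

theorem nonempty_boundary_homeomorph {G' : Type*} [Group G'] {S' : Set G'} {f' : ℕ → ℝ}
    (e : FloydGraph f S ≃ᵤ FloydGraph f' S') :
    Nonempty (FloydBoundary f S ≃ₜ FloydBoundary f' S') := by
  refine ⟨(Completion.mapEquiv e).toHomeomorph.subtype fun x => not_congr ?_⟩
  constructor
  · rintro ⟨v, rfl⟩
    exact ⟨e v, (Completion.mapEquiv_coe e v).symm⟩
  · rintro ⟨w, hw⟩
    refine ⟨e.symm w, (Completion.mapEquiv e).injective ?_⟩
    rw [Completion.mapEquiv_coe, e.apply_symm_apply]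
    exact hw

theorem nonempty_boundary_homeomorph_of_le {G' : Type*} [Group G'] {S' : Set G'} {f' : ℕ → ℝ}
    (e : G ≃ G') {C C' : ℝ≥0}
    (h : ∀ v w, floydEDist f' S' (e v) (e w) ≤ C * floydEDist f S v w)
    (h' : ∀ v w, floydEDist f S (e.symm v) (e.symm w) ≤ C' * floydEDist f' S' v w) :
    Nonempty (FloydBoundary f S ≃ₜ FloydBoundary f' S') := by
  let e' : FloydGraph f S ≃ FloydGraph f' S' := e
  have h1 : UniformContinuous e' := uniformContinuous_of_floydEDist_le (φ := e') h
  have h2 : UniformContinuous e'.symm := uniformContinuous_of_floydEDist_le (φ := e'.symm) h'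
  exact nonempty_boundary_homeomorph ⟨e', h1, h2⟩

end completion

end Floyd

/-! ### Gates and the Floyd distance of a free product. -/

namespace Floyd

open Topology Filter Set
open scoped NNReal

/-- The generating set of a free product given by generating sets of the factors. -/
def factorGens {ι : Type*} {H : ι → Type*} [∀ i, Group (H i)] {G : Type*} [Group G]
    (of : ∀ i, H i →* G) (T : ∀ i, Set (H i)) : Set G :=
  ⋃ i, of i '' T i

namespace FreeProjections

variable {ι : Type*} {H : ι → Type*} [∀ i, Group (H i)] {G : Type*} [Group G]
  {of : ∀ i, H i →* G} {π : ∀ i, G → H i} (h : FreeProjections of π) {T : ∀ i, Set (H i)}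

include h

theorem closure_factorGens (hT : ∀ i, Subgroup.closure (T i) = ⊤) :
    Subgroup.closure (factorGens of T) = ⊤ := by
  rw [eq_top_iff, ← h.closure_eq, Subgroup.closure_le]
  refine iUnion_subset fun i => ?_
  rintro _ ⟨a, rfl⟩
  have ha : of i a ∈ (Subgroup.closure (T i)).map (of i) := ⟨a, hT i ▸ Subgroup.mem_top a, rfl⟩
  rw [MonoidHom.map_closure] at ha
  exact Subgroup.closure_mono (subset_iUnion (fun i => of i '' T i) i) ha

theorem adj_of (i : ι) (w : G) {a b : H i} (hab : (SimpleGraph.mulCayley (T i)).Adj a b) :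
    (SimpleGraph.mulCayley (factorGens of T)).Adj (w * of i a) (w * of i b) := by
  rw [SimpleGraph.mulCayley_adj_mul_iff_right, SimpleGraph.mulCayley_adj]
  rw [SimpleGraph.mulCayley_adj] at hab
  refine ⟨fun he => hab.1 (h.injective_of i he), hab.2.imp (fun hs => ?_) fun hs => ?_⟩ <;>
  · rw [← map_inv, ← map_mul]
    exact mem_iUnion.2 ⟨i, _, hs, rfl⟩

/-- The gate in the coset `w * H i` changes only along edges of that coset. -/
theorem exists_of_adj {i : ι} {w v v' : G}
    (hadj : (SimpleGraph.mulCayley (factorGens of T)).Adj v v')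
    (hne : π i (w⁻¹ * v) ≠ π i (w⁻¹ * v')) :
    ∃ a b, v = w * of i a ∧ v' = w * of i b ∧ (SimpleGraph.mulCayley (T i)).Adj a b := by
  have key : ∀ v v' : G, v⁻¹ * v' ∈ factorGens of T → π i (w⁻¹ * v) ≠ π i (w⁻¹ * v') →
      ∃ a b, v = w * of i a ∧ v' = w * of i b ∧ (SimpleGraph.mulCayley (T i)).Adj a b := by
    intro v v' hs hne
    obtain ⟨j, s, hs, hvs⟩ := mem_iUnion.1 hs
    have hv' : w⁻¹ * v' = w⁻¹ * v * of j s := by rw [hvs]; group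
    rcases h.proj_mul_of i j s (w⁻¹ * v) with he | ⟨rfl, a, ha⟩
    · exact absurd (by rw [hv', he]) hne
    · refine ⟨a, a * s, by rw [ha]; group, by rw [map_mul, ha, ← hv']; group, ?_⟩
      rw [SimpleGraph.mulCayley_adj]
      refine ⟨fun he => hne ?_, Or.inl (by simpa using hs)⟩
      rw [hv', ← ha, ← map_mul, ← he]
  rcases ((SimpleGraph.mulCayley_adj _ _ _).1 hadj).2 with hs | hs
  · exact key v v' hs hne
  · obtain ⟨a, b, ha, hb, hab⟩ := key v' v hs hne.symm
    exact ⟨b, a, hb, ha, hab.symm⟩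

/-- A path along which the gate in `w * H i` changes passes through the gate of its endpoint. -/
theorem gate_mem_support {i : ι} {w v g : G}
    (p : (SimpleGraph.mulCayley (factorGens of T)).Walk v g)
    (hne : π i (w⁻¹ * v) ≠ π i (w⁻¹ * g)) : w * of i (π i (w⁻¹ * g)) ∈ p.support := by
  induction p with
  | nil => exact absurd rfl hne
  | @cons v v' g hadj q ih =>
    rw [SimpleGraph.Walk.support_cons, List.mem_cons]
    right
    by_cases he : π i (w⁻¹ * v') = π i (w⁻¹ * g)
    · obtain ⟨a, b, -, rfl, -⟩ := h.exists_of_adj hadj (he ▸ hne)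
      rw [inv_mul_cancel_left, h.proj_of] at he
      rw [← he]
      exact q.start_mem_support
    · exact ih he

theorem gate_mem_support' {i : ι} {w v g : G}
    (p : (SimpleGraph.mulCayley (factorGens of T)).Walk v g)
    (hne : π i (w⁻¹ * v) ≠ π i (w⁻¹ * g)) : w * of i (π i (w⁻¹ * v)) ∈ p.support := by
  have := h.gate_mem_support p.reverse hne.symm
  rwa [SimpleGraph.Walk.support_reverse, List.mem_reverse] at this

variable (hT : ∀ i, Subgroup.closure (T i) = ⊤)

include hT

theorem wordLength_of_le (i : ι) (a : H i) :
    wordLength (factorGens of T) (of i a) ≤ wordLength (T i) a := by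
  obtain ⟨p, hp⟩ := (connected_mulCayley (hT i)).exists_walk_length_eq_dist 1 a
  let φ : SimpleGraph.mulCayley (T i) →g SimpleGraph.mulCayley (factorGens of T) :=
    ⟨fun x => of i x, fun hx => by simpa using h.adj_of i 1 hx⟩
  have := SimpleGraph.dist_le (p.map φ)
  rw [SimpleGraph.Walk.length_map, hp] at this
  simpa [wordLength, φ] using this

theorem wordLength_proj_le (i : ι) (g : G) :
    wordLength (T i) (π i g) ≤ wordLength (factorGens of T) g := by
  have hS := h.closure_factorGens hT
  have key : ∀ n g, wordLength (factorGens of T) g = n → wordLength (T i) (π i g) ≤ n := by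
    intro n
    induction n with
    | zero =>
      intro g hg
      obtain rfl : 1 = g := (connected_mulCayley hS).dist_eq_zero_iff.1 hg
      rw [h.proj_one, wordLength_one]
    | succ n ih =>
      intro g hg
      obtain ⟨g', hadj, hg'⟩ := exists_pred hS hg
      have h1 := wordLength_adj hS hadj
      have h2 := ih g' (by lia)
      by_cases he : π i g' = π i g
      · rw [← he]
        lia
      · obtain ⟨a, b, rfl, rfl, hab⟩ := h.exists_of_adj (i := i) (w := 1) hadj (by simpa using he)
        rw [one_mul, h.proj_of] at h2 ⊢
        have := wordLength_adj (hT i) hab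
        lia
  exact key _ g rfl

theorem wordLength_le_mul_of (i : ι) (w : G) (a : H i) :
    wordLength (T i) a ≤ wordLength (factorGens of T) (w * of i a) +
      wordLength (factorGens of T) w := by
  have h1 := h.wordLength_proj_le hT i (of i a)
  have h2 := wordLength_le_add_mul (h.closure_factorGens hT) w (of i a)
  rw [h.proj_of] at h1
  lia

theorem wordLength_mul_of_le (i : ι) (w : G) (a : H i) :
    wordLength (factorGens of T) (w * of i a) ≤ wordLength (T i) a +
      wordLength (factorGens of T) w := by
  have h1 := h.wordLength_of_le hT i a
  have h2 := wordLength_mul_le (h.closure_factorGens hT) w (of i a)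
  lia

variable {f : ℕ → ℝ} (hf : IsFloydFunction f)

include hf

/-- The gate map collapses all edges except those of `w * H i`, where lengths in `H i` and in `G`
differ by at most the length of `w`. -/
theorem exists_gate_lipschitz (i : ι) (w : G) : ∃ C : ℝ≥0, ∀ v v',
    floydEDist f (T i) (π i (w⁻¹ * v)) (π i (w⁻¹ * v')) ≤
      C * floydEDist f (factorGens of T) v v' := by
  obtain ⟨C, hC, hCf⟩ := hf.exists_shift (wordLength (factorGens of T) w)
  refine ⟨C, floydEDist_map_le hf hC (fun v => π i (w⁻¹ * v)) fun v v' hadj => ?_⟩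
  by_cases he : π i (w⁻¹ * v) = π i (w⁻¹ * v')
  · rw [he, floydEDist_self]
    exact bot_le
  obtain ⟨a, b, rfl, rfl, hab⟩ := h.exists_of_adj hadj he
  rw [inv_mul_cancel_left, inv_mul_cancel_left, h.proj_of, h.proj_of]
  refine (floydEDist_le_of_adj hab).trans ?_
  rw [← ENNReal.ofReal_coe_nnreal, ← ENNReal.ofReal_mul C.coe_nonneg]
  refine ENNReal.ofReal_le_ofReal (hCf _ _ ?_)
  have h1 := h.wordLength_mul_of_le hT i w a
  have h2 := h.wordLength_mul_of_le hT i w b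
  lia

theorem exists_piece_lipschitz (i : ι) (w : G) : ∃ C : ℝ≥0, ∀ a b : H i,
    floydEDist f (factorGens of T) (w * of i a) (w * of i b) ≤
      C * floydEDist f (T i) a b := by
  obtain ⟨C, hC, hCf⟩ := hf.exists_shift (wordLength (factorGens of T) w)
  refine ⟨C, floydEDist_map_le hf hC (fun a => w * of i a) fun a b hab => ?_⟩
  refine (floydEDist_le_of_adj (h.adj_of i w hab)).trans ?_
  rw [← ENNReal.ofReal_coe_nnreal, ← ENNReal.ofReal_mul C.coe_nonneg]
  refine ENNReal.ofReal_le_ofReal (hCf _ _ ?_)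
  have h1 := h.wordLength_le_mul_of hT i w a
  have h2 := h.wordLength_le_mul_of hT i w b
  lia

/-- Since `1` and `g` have different gates, every path between them meets the gate of `g`, which
therefore lies on a geodesic from `1`. -/
theorem floydEDist_gate_le {i : ι} {w g : G} (hne : π i w⁻¹ ≠ π i (w⁻¹ * g)) :
    floydEDist f (factorGens of T) (w * of i (π i (w⁻¹ * g))) g ≤
      ENNReal.ofReal (tailSum f (wordLength (factorGens of T) (w * of i (π i (w⁻¹ * g))))) :=
  floydEDist_le_tailSum hf (h.closure_factorGens hT)
    (wordLength_eq_add_dist (h.closure_factorGens hT)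
      fun p => h.gate_mem_support p (by simpa using hne))

omit hf in
/-- If the coset `w * H i` lies behind `w`, then so do its points. -/
theorem wordLength_mul_of {i : ι} {w : G} (hw : π i w⁻¹ = 1) (a : H i) :
    wordLength (factorGens of T) (w * of i a) = wordLength (factorGens of T) w +
      (SimpleGraph.mulCayley (factorGens of T)).dist w (w * of i a) := by
  by_cases ha : a = 1
  · rw [ha, map_one, mul_one, SimpleGraph.dist_self, add_zero]
  · refine wordLength_eq_add_dist (h.closure_factorGens hT) fun p => ?_
    have := h.gate_mem_support' (i := i) (w := w) p (by
      rw [mul_one, hw, inv_mul_cancel_left, h.proj_of]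
      exact Ne.symm ha)
    rwa [mul_one, hw, map_one, mul_one] at this

theorem floydEDist_mul_of_le {i : ι} {w : G} (hw : π i w⁻¹ = 1) (a : H i) :
    floydEDist f (factorGens of T) w (w * of i a) ≤
      ENNReal.ofReal (tailSum f (wordLength (factorGens of T) w)) :=
  floydEDist_le_tailSum hf (h.closure_factorGens hT) (h.wordLength_mul_of hT hw a)

/-- Elements with the same gates in all cosets near `1` are close. -/
theorem floydEDist_le_of_gates {n : ℕ} {g g' : G}
    (hgate : ∀ w, wordLength (factorGens of T) w ≤ n → ∀ i, π i w⁻¹ = 1 →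
      π i (w⁻¹ * g) = π i (w⁻¹ * g')) :
    floydEDist f (factorGens of T) g g' ≤ ENNReal.ofReal (2 * tailSum f n) := by
  have hS := h.closure_factorGens hT
  -- The representative of a coset can be moved to the gate of `1`, which is no longer than `w`.
  have hgate' : ∀ w, wordLength (factorGens of T) w ≤ n → ∀ i,
      π i (w⁻¹ * g) = π i (w⁻¹ * g') := by
    intro w hw i
    have h1 : ∀ x, π i ((w * of i (π i w⁻¹))⁻¹ * x) = (π i w⁻¹)⁻¹ * π i (w⁻¹ * x) := fun x => by
      rw [mul_inv_rev, mul_assoc, ← map_inv, h.proj_of_mul]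
    have h2 : wordLength (factorGens of T) (w * of i (π i w⁻¹)) ≤ n := by
      have h3 : π i (w * of i (π i w⁻¹))⁻¹ = 1 := by simpa using h1 1
      have := h.wordLength_mul_of hT h3 (π i w⁻¹)⁻¹
      rw [map_inv, mul_inv_cancel_right] at this
      lia
    have h3 := hgate _ h2 i (by simpa using h1 1)
    rw [h1, h1] at h3
    exact mul_left_cancel h3
  rcases le_or_gt (wordLength (factorGens of T) g) n with hg | hg
  · have : g⁻¹ * g' = 1 := h.eq_one _ fun i => by
      rw [← hgate' g hg i, inv_mul_cancel, h.proj_one]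
    rw [← inv_mul_eq_one.1 this, floydEDist_self]
    exact bot_le
  obtain ⟨x, hx, hxg⟩ := exists_geodesic_point hS hg.le
  have hne : x⁻¹ * g ≠ 1 := fun he => by
    rw [inv_mul_eq_one.1 he] at hx
    lia
  obtain ⟨i, hi⟩ : ∃ i, π i (x⁻¹ * g) ≠ 1 := by
    by_contra! hall
    exact hne (h.eq_one _ hall)
  -- The gate of `g` in the coset through the geodesic point `x` in the direction of `g`. It is
  -- longer than `x`, so it is not the gate of `1`, and `g'` has the same gate: both elements are
  -- within a tail of `y`.
  set y := x * of i (π i (x⁻¹ * g)) with hy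
  have hd := dist_eq_add_dist hS (u := x) (x := y) (g := g) fun p =>
    h.gate_mem_support p (by rw [inv_mul_cancel, h.proj_one]; exact hi.symm)
  have hxy : (SimpleGraph.mulCayley (factorGens of T)).dist x y ≠ 0 := fun h0 => by
    have := (connected_mulCayley hS).dist_eq_zero_iff.1 h0
    rw [hy, left_eq_mul, ← map_one (of i)] at this
    exact hi (h.injective_of i this)
  have h1 : wordLength (factorGens of T) y ≤ wordLength (factorGens of T) x + _ :=
    (connected_mulCayley hS).dist_triangle (v := x)
  have h2 : wordLength (factorGens of T) g ≤ wordLength (factorGens of T) y + _ :=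
    (connected_mulCayley hS).dist_triangle (v := y)
  have hne' : π i x⁻¹ ≠ π i (x⁻¹ * g) := by
    intro he
    have := wordLength_eq_add_dist hS (x := y) (g := x) fun p => by
      rw [hy, ← he]
      have := h.gate_mem_support' (i := i) (w := x) p (by
        rw [mul_one, inv_mul_cancel, h.proj_one, he]; exact hi)
      rwa [mul_one] at this
    lia
  have e1 := h.floydEDist_gate_le hT hf hne'
  have hg' := hgate' x hx.le i
  have e2 := h.floydEDist_gate_le hT hf (g := g') (by rwa [← hg'])
  rw [← hg'] at e2
  rw [← hy] at e1 e2
  have ht : tailSum f (wordLength (factorGens of T) y) ≤ tailSum f n :=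
    tailSum_antitone hf (by lia)
  rw [two_mul, ENNReal.ofReal_add (tailSum_nonneg hf n) (tailSum_nonneg hf n)]
  refine (floydEDist_triangle _ _ _ y _).trans (add_le_add ?_ ?_)
  · rw [floydEDist_comm]
    exact e1.trans (ENNReal.ofReal_le_ofReal ht)
  · exact e2.trans (ENNReal.ofReal_le_ofReal ht)

end FreeProjections

end Floyd

/-! ### The gate system on the Floyd boundary of a free product. -/

namespace Floyd

open Topology Filter Set UniformSpace
open scoped NNReal

/-- The extension to the Floyd completions of the gate map of the coset `w * H i`. -/
noncomputable def gateMap {ι : Type*} {H : ι → Type*} [∀ i, Group (H i)] {G : Type*} [Group G]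
    (f : ℕ → ℝ) (S : Set G) (T : ∀ i, Set (H i)) (π : ∀ i, G → H i) (i : ι) (w : G) :
    FloydCompletion f S → FloydCompletion f (T i) :=
  Completion.map (α := FloydGraph f S) (β := FloydGraph f (T i)) fun g : G => π i (w⁻¹ * g)

/-- The extension to the Floyd completions of the inclusion of the coset `w * H i`. -/
noncomputable def pieceMap {ι : Type*} {H : ι → Type*} [∀ i, Group (H i)] {G : Type*} [Group G]
    (f : ℕ → ℝ) (S : Set G) (T : ∀ i, Set (H i)) (of : ∀ i, H i →* G) (i : ι) (w : G) :
    FloydCompletion f (T i) → FloydCompletion f S :=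
  Completion.map (α := FloydGraph f (T i)) (β := FloydGraph f S) fun a : H i => w * of i a

/-- The Floyd boundary as a subset of the Floyd completion. -/
abbrev boundarySet {G : Type*} [Group G] (f : ℕ → ℝ) (S : Set G) : Set (FloydCompletion f S) :=
  (range ((↑) : FloydGraph f S → FloydCompletion f S))ᶜ

/-- A vertex of the Cayley graph as a point of the Floyd completion. -/
noncomputable abbrev vertex {G : Type*} [Group G] (f : ℕ → ℝ) (S : Set G) (g : G) : FloydCompletion f S :=
  Completion.coe' (α := FloydGraph f S) g

theorem denseRange_vertex {G : Type*} [Group G] (f : ℕ → ℝ) (S : Set G) :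
    DenseRange (vertex f S) := Completion.denseRange_coe (α := FloydGraph f S)

theorem notMem_boundarySet {G : Type*} [Group G] {f : ℕ → ℝ} {S : Set G}
    {x : FloydCompletion f S} : x ∉ boundarySet f S ↔ ∃ g : G, vertex f S g = x :=
  notMem_compl_iff

namespace FreeProjections

variable {ι : Type*} {H : ι → Type*} [∀ i, Group (H i)] {G : Type*} [Group G]
  {of : ∀ i, H i →* G} {π : ∀ i, G → H i} (h : FreeProjections of π) {T : ∀ i, Set (H i)}
  (hT : ∀ i, Subgroup.closure (T i) = ⊤) {f : ℕ → ℝ} (hf : IsFloydFunction f)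

theorem continuous_gateMap (i : ι) (w : G) :
    Continuous (gateMap f (factorGens of T) T π i w) :=
  Completion.continuous_map

theorem continuous_pieceMap (i : ι) (w : G) :
    Continuous (pieceMap f (factorGens of T) T of i w) :=
  Completion.continuous_map

include h hT hf

theorem gateMap_coe (i : ι) (w g : G) :
    gateMap f (factorGens of T) T π i w (vertex f _ g) = vertex f _ (π i (w⁻¹ * g)) := by
  obtain ⟨C, hC⟩ := h.exists_gate_lipschitz hT hf i w
  exact Completion.map_coe (α := FloydGraph f (factorGens of T)) (β := FloydGraph f (T i))
    (uniformContinuous_of_floydEDist_le hC) g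

theorem pieceMap_coe (i : ι) (w : G) (a : H i) :
    pieceMap f (factorGens of T) T of i w (vertex f _ a) = vertex f _ (w * of i a) := by
  obtain ⟨C, hC⟩ := h.exists_piece_lipschitz hT hf i w
  exact Completion.map_coe (α := FloydGraph f (T i)) (β := FloydGraph f (factorGens of T))
    (uniformContinuous_of_floydEDist_le hC) a

theorem gateMap_pieceMap (i : ι) (w : G) (x : FloydCompletion f (T i)) :
    gateMap f (factorGens of T) T π i w (pieceMap f (factorGens of T) T of i w x) = x := by
  refine isClosed_property (denseRange_vertex f (T i)) (isClosed_eq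
    ((continuous_gateMap i w).comp (continuous_pieceMap i w)) continuous_id) (fun a => ?_) x
  rw [Function.comp_apply, h.pieceMap_coe hT hf i w a, h.gateMap_coe hT hf, inv_mul_cancel_left, h.proj_of]
  rfl

theorem pieceMap_mem_boundarySet {i : ι} {w : G} {x : FloydCompletion f (T i)}
    (hx : x ∈ boundarySet f (T i)) :
    pieceMap f (factorGens of T) T of i w x ∈ boundarySet f (factorGens of T) := by
  by_contra hcon
  obtain ⟨g, hg⟩ := notMem_boundarySet.1 hcon
  have := h.gateMap_pieceMap hT hf i w x
  rw [← hg, h.gateMap_coe hT hf i w g] at this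
  exact notMem_boundarySet.2 ⟨_, this⟩ hx

/-- A vertex with a long gate is close to that gate, so a point whose gate is at infinity equals it.
-/
theorem pieceMap_gateMap (hfin : ∀ i, (T i).Finite) {i : ι} {w : G} (hw : π i w⁻¹ = 1)
    {ξ : FloydCompletion f (factorGens of T)}
    (hξ : gateMap f (factorGens of T) T π i w ξ ∈ boundarySet f (T i)) :
    pieceMap f (factorGens of T) T of i w (gateMap f (factorGens of T) T π i w ξ) = ξ := by
  have hS := h.closure_factorGens hT
  let _ := completionMetric f hS
  have hcont := (continuous_pieceMap (of := of) (T := T) (f := f) i w).comp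
    (continuous_gateMap (of := of) (T := T) (f := f) (π := π) i w)
  have hle : ∀ n, dist (pieceMap f (factorGens of T) T of i w
      (gateMap f (factorGens of T) T π i w ξ)) ξ ≤ tailSum f n := by
    intro n
    set N := n + wordLength (factorGens of T) w
    -- Having one of finitely many short gates is a closed condition too, so the dichotomy passes
    -- from vertices to `ξ`. The margin in `N` turns a long gate in `H i` into one longer than `n`
    -- in `G`.
    have hclosed : IsClosed {ξ | gateMap f (factorGens of T) T π i w ξ ∈
        vertex f (T i) '' {a | wordLength (T i) a ≤ N} ∨
        dist (pieceMap f (factorGens of T) T of i w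
          (gateMap f (factorGens of T) T π i w ξ)) ξ ≤ tailSum f n} := by
      refine IsClosed.union ?_ (isClosed_le (hcont.dist continuous_id) continuous_const)
      exact (((finite_ball (hT i) (hfin i) N).image _).isClosed).preimage (continuous_gateMap i w)
    have := isClosed_property (denseRange_vertex f _) hclosed (fun g => ?_) ξ
    · refine this.resolve_left ?_
      rintro ⟨a, -, ha⟩
      exact hξ ⟨a, ha⟩
    · have e1 := h.gateMap_coe hT hf i w g
      rw [e1]
      by_cases ha : wordLength (T i) (π i (w⁻¹ * g)) ≤ N
      · exact Or.inl ⟨_, ha, rfl⟩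
      right
      rw [h.pieceMap_coe hT hf i w]
      refine dist_coe_le hS (tailSum_nonneg hf n) ?_
      have hne : π i w⁻¹ ≠ π i (w⁻¹ * g) := fun he => ha (by
        rw [← he, hw, wordLength_one]; exact Nat.zero_le _)
      refine (h.floydEDist_gate_le hT hf hne).trans
        (ENNReal.ofReal_le_ofReal (tailSum_antitone hf ?_))
      have := h.wordLength_le_mul_of hT i w (π i (w⁻¹ * g))
      lia
  refine dist_le_zero.1 (ge_of_tendsto' (tendsto_tailSum (f := f)) hle)

/-- A gate at infinity determines the point outright. If there is none, all gates are isolated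
vertices, so vertices near `ξ` and near `η` share the finitely many gates that
`floydEDist_le_of_gates` asks for. -/
theorem eq_of_gateMap_eq [Finite ι] (hfin : ∀ i, (T i).Finite)
    {ξ η : FloydCompletion f (factorGens of T)}
    (heq : ∀ i w, π i w⁻¹ = 1 → gateMap f (factorGens of T) T π i w ξ =
      gateMap f (factorGens of T) T π i w η) : ξ = η := by
  have hS := h.closure_factorGens hT
  have hSfin : (factorGens of T).Finite := finite_iUnion fun i => (hfin i).image _
  by_cases hX : ∃ i w, π i w⁻¹ = 1 ∧ gateMap f (factorGens of T) T π i w ξ ∈ boundarySet f (T i)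
  · obtain ⟨i, w, hw, hξ⟩ := hX
    rw [← h.pieceMap_gateMap hT hf hfin hw hξ, heq i w hw,
      h.pieceMap_gateMap hT hf hfin hw (heq i w hw ▸ hξ)]
  push Not at hX
  let _ := completionMetric f hS
  have hle : ∀ n, dist ξ η ≤ 2 * tailSum f n := by
    intro n
    set F : Set (G × ι) := {p | wordLength (factorGens of T) p.1 ≤ n ∧ π p.2 p.1⁻¹ = 1}
    have hF : F.Finite := ((finite_ball hS hSfin n).prod (finite_univ (α := ι))).subset
      fun p hp => ⟨hp.1, mem_univ _⟩
    set O : Set (FloydCompletion f (factorGens of T)) := ⋂ p ∈ F,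
      gateMap f (factorGens of T) T π p.2 p.1 ⁻¹' {gateMap f (factorGens of T) T π p.2 p.1 ξ}
    have hO : IsOpen O := hF.isOpen_biInter fun p hp => by
      refine IsOpen.preimage (continuous_gateMap _ _) ?_
      obtain ⟨a, ha⟩ := notMem_boundarySet.1 (hX p.2 p.1 hp.2)
      rw [← ha]
      exact isOpen_singleton_coe hf a
    have hξO : ξ ∈ O := mem_iInter₂.2 fun p _ => rfl
    have hηO : η ∈ O := mem_iInter₂.2 fun p hp => (heq p.2 p.1 hp.2).symm
    have hcl := (denseRange_vertex f _).open_subset_closure_inter hO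
    have hmem : (ξ, η) ∈ closure ((O ∩ range (vertex f (factorGens of T))) ×ˢ
        (O ∩ range (vertex f (factorGens of T)))) := by
      rw [closure_prod_eq]
      exact ⟨hcl hξO, hcl hηO⟩
    refine closure_minimal (t := {p : _ × _ | dist p.1 p.2 ≤ 2 * tailSum f n}) ?_
      (isClosed_le continuous_dist continuous_const) hmem
    rintro ⟨_, _⟩ ⟨⟨hg, g, rfl⟩, ⟨hg', g', rfl⟩⟩
    refine dist_coe_le hS (by have := tailSum_nonneg hf n; positivity)
      (h.floydEDist_le_of_gates hT hf fun w hw i hwi => ?_)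
    have e1 := mem_iInter₂.1 hg (w, i) ⟨hw, hwi⟩
    have e2 := mem_iInter₂.1 hg' (w, i) ⟨hw, hwi⟩
    have e3 : gateMap f (factorGens of T) T π i w (vertex f _ g) =
      gateMap f (factorGens of T) T π i w (vertex f _ g') := Eq.trans e1 (Eq.symm e2)
    rw [h.gateMap_coe hT hf, h.gateMap_coe hT hf] at e3
    exact coe_injective_of_isFloydFunction hf e3
  have hlim := (tendsto_tailSum (f := f)).const_mul 2
  rw [mul_zero] at hlim
  exact dist_le_zero.1 (ge_of_tendsto' hlim hle)

theorem gateMap_tree {i l : ι} {w v : G} (hne : ¬(i = l ∧ w⁻¹ * v ∈ (of i).range))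
    (ξ : FloydCompletion f (factorGens of T)) :
    gateMap f (factorGens of T) T π l v ξ = vertex f (T l) (π l (v⁻¹ * w)) ∨
      gateMap f (factorGens of T) T π i w ξ = vertex f (T i) (π i (w⁻¹ * v)) := by
  refine isClosed_property (p := fun ξ => gateMap f (factorGens of T) T π l v ξ = _ ∨
    gateMap f (factorGens of T) T π i w ξ = _) (denseRange_vertex f _) ?_ (fun g => ?_) ξ
  · exact (isClosed_eq (continuous_gateMap l v) continuous_const).union
      (isClosed_eq (continuous_gateMap i w) continuous_const)
  · have e1 := h.gateMap_coe hT hf l v g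
    have e2 := h.gateMap_coe hT hf i w g
    rw [e1, e2]
    exact (h.tree hne g).imp (fun he => by rw [he]) fun he => by rw [he]

/-- Pieces over any given factor accumulate at every boundary point. -/
theorem exists_piece_near [Finite ι] [Nontrivial ι] [∀ i, Infinite (H i)]
    (hfin : ∀ i, (T i).Finite) (i : ι) {O : Set (FloydCompletion f (factorGens of T))}
    (hO : IsOpen O) {ξ : FloydCompletion f (factorGens of T)} (hξO : ξ ∈ O)
    (hξ : ξ ∈ boundarySet f (factorGens of T)) :
    ∃ w, π i w⁻¹ = 1 ∧ ∃ x ∈ boundarySet f (T i),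
      pieceMap f (factorGens of T) T of i w x ∈ O := by
  have hS := h.closure_factorGens hT
  have hSfin : (factorGens of T).Finite := finite_iUnion fun i => (hfin i).image _
  let _ := completionMetric f hS
  obtain ⟨ε, hε, hεO⟩ := Metric.isOpen_iff.1 hO ξ hξO
  obtain ⟨m, hm⟩ := ((tendsto_tailSum (f := f)).eventually_lt_const
    (show (0 : ℝ) < ε / 3 by positivity)).exists
  obtain ⟨x, hx⟩ := nonempty_boundary hf (hT i) (hfin i)
  obtain ⟨l, hl⟩ := exists_ne i
  obtain ⟨b, hb⟩ := exists_ne (1 : H l)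
  have hN := ((finite_ball hS hSfin m).image (vertex f (factorGens of T))).isClosed
  obtain ⟨y, ⟨hyb, hyN⟩, g, rfl⟩ := (denseRange_vertex f _).inter_open_nonempty
    (Metric.ball ξ (ε / 3) ∩ (vertex f (factorGens of T) ''
      {g | wordLength (factorGens of T) g ≤ m})ᶜ) (Metric.isOpen_ball.inter hN.isOpen_compl)
    ⟨ξ, Metric.mem_ball_self (by positivity), by rintro ⟨a, -, ha⟩; exact hξ ⟨a, ha⟩⟩
  have hg : m < wordLength (factorGens of T) g := by
    by_contra hle
    exact hyN ⟨g, not_lt.1 hle, rfl⟩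
  -- If `g` ends in a syllable from `H i`, appending a letter of another factor gives a `w` that
  -- does not; otherwise `g` itself serves. The coset `w * H i` then leads away from `1` and is
  -- small.
  have key : ∃ w, π i w⁻¹ = 1 ∧ m ≤ wordLength (factorGens of T) w ∧
      floydEDist f (factorGens of T) g w ≤ ENNReal.ofReal (tailSum f m) := by
    by_cases hgi : π i (g : G)⁻¹ = 1
    · exact ⟨g, hgi, hg.le, by rw [floydEDist_self]; exact bot_le⟩
    · have hgl := h.proj_eq_one l i _ hl hgi
      refine ⟨g * of l b, ?_, ?_, ?_⟩
      · rw [mul_inv_rev, ← map_inv]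
        refine h.proj_eq_one i l _ hl.symm ?_
        rw [h.proj_of_mul, hgl, mul_one]
        exact inv_ne_one.2 hb
      · rw [h.wordLength_mul_of hT hgl b]
        lia
      · exact (h.floydEDist_mul_of_le hT hf hgl b).trans
          (ENNReal.ofReal_le_ofReal (tailSum_antitone hf hg.le))
  obtain ⟨w, hw, hmw, hgw⟩ := key
  refine ⟨w, hw, x, hx, hεO ?_⟩
  have h1 : dist (vertex f (factorGens of T) g) (vertex f _ w) ≤ tailSum f m :=
    dist_coe_le hS (tailSum_nonneg hf m) hgw
  have h2 : dist (vertex f _ w) (pieceMap f (factorGens of T) T of i w x) ≤ tailSum f m := by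
    refine isClosed_property (denseRange_vertex f (T i)) (isClosed_le
      (continuous_const.dist (continuous_pieceMap i w)) continuous_const) (fun a => ?_) x
    rw [h.pieceMap_coe hT hf i w a]
    exact dist_coe_le hS (tailSum_nonneg hf m) ((h.floydEDist_mul_of_le hT hf hw a).trans
      (ENNReal.ofReal_le_ofReal (tailSum_antitone hf hmw)))
  have h3 : dist (vertex f (factorGens of T) g) ξ < ε / 3 := hyb
  rw [Metric.mem_ball]
  have := dist_triangle (pieceMap f (factorGens of T) T of i w x) (vertex f _ w) ξ
  have := dist_triangle (vertex f _ w) (vertex f (factorGens of T) g) ξ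
  rw [dist_comm] at h1 h2
  linarith

/-- The Floyd boundary of a free product carries a gate system. -/
noncomputable def gateSystem [Finite ι] [Nontrivial ι] [∀ i, Infinite (H i)]
    (hfin : ∀ i, (T i).Finite) {κ : Type*} {color : ι → κ} (hcolor : Function.Surjective color) :
    GateSystem (FloydBoundary f (factorGens of T))
      (I := {p : G × ι // π p.2 p.1⁻¹ = 1}) (fun j => FloydCompletion f (T j.1.2))
      (fun j => boundarySet f (T j.1.2)) (fun j => color j.1.2) where
  gate j ξ := gateMap f (factorGens of T) T π j.1.2 j.1.1 ξ.1
  base j k := vertex f (T k.1.2) (π k.1.2 (k.1.1⁻¹ * j.1.1))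
  continuous_gate j := (continuous_gateMap _ _).comp continuous_subtype_val
  isOpen_singleton j a ha := by
    obtain ⟨v, rfl⟩ := notMem_boundarySet.1 ha
    exact isOpen_singleton_coe hf v
  countable j := by
    have := countable_of_closure (hT j.1.2) (hfin j.1.2)
    rw [compl_compl]
    exact @countable_range _ _ this _
  nonempty j := nonempty_boundary hf (hT _) (hfin _)
  base_notMem j k _ := notMem_boundarySet.2 ⟨_, rfl⟩
  tree := by
    rintro ⟨⟨w, i⟩, hw⟩ ⟨⟨v, l⟩, hv⟩ hne ξ
    refine h.gateMap_tree hT hf ?_ ξ.1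
    -- The condition `π i w⁻¹ = 1` selects one representative of each coset, namely the gate of `1`.
    rintro ⟨rfl, a, ha⟩
    dsimp only at hw hv ha
    have hv' : v⁻¹ = of i a⁻¹ * w⁻¹ := by rw [map_inv, ha]; group
    rw [hv', h.proj_of_mul, hw, mul_one, inv_eq_one] at hv
    rw [hv, map_one, eq_comm, inv_mul_eq_one] at ha
    exact hne (by simp [ha])
  separating ξ η heq := Subtype.ext
    (h.eq_of_gateMap_eq hT hf hfin fun i w hw => heq ⟨(w, i), hw⟩)
  surjective j x hx := ⟨⟨_, h.pieceMap_mem_boundarySet hT hf hx⟩, h.gateMap_pieceMap hT hf _ _ x⟩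
  dense c U hU := by
    rintro ⟨ξ, hξ⟩
    obtain ⟨i, rfl⟩ := hcolor c
    obtain ⟨O, hO, rfl⟩ := isOpen_induced_iff.1 hU
    obtain ⟨w, hw, x, hx, hxO⟩ := h.exists_piece_near hT hf hfin i hO hξ ξ.2
    refine ⟨⟨(w, i), hw⟩, rfl, ⟨_, h.pieceMap_mem_boundarySet hT hf hx⟩, hxO, ?_⟩
    exact (h.gateMap_pieceMap hT hf i w x).symm ▸ hx

end FreeProjections

/-- The Floyd boundaries of two free products are homeomorphic if their factors come in the same
colours and factors of the same colour have homeomorphic Floyd boundaries. -/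
theorem nonempty_boundary_homeomorph_of_freeProjections {ι ι' κ : Type*} [Finite ι] [Finite ι']
    [Nontrivial ι] [Nontrivial ι'] [Nontrivial κ] {H : ι → Type*} {H' : ι' → Type*}
    [∀ i, Group (H i)] [∀ i, Group (H' i)] [∀ i, Infinite (H i)] [∀ i, Infinite (H' i)]
    {G G' : Type*} [Group G] [Group G'] {of : ∀ i, H i →* G} {of' : ∀ i, H' i →* G'}
    {π : ∀ i, G → H i} {π' : ∀ i, G' → H' i} (h : FreeProjections of π)
    (h' : FreeProjections of' π') {T : ∀ i, Set (H i)} {T' : ∀ i, Set (H' i)}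
    (hT : ∀ i, Subgroup.closure (T i) = ⊤) (hT' : ∀ i, Subgroup.closure (T' i) = ⊤)
    (hfin : ∀ i, (T i).Finite) (hfin' : ∀ i, (T' i).Finite) {f : ℕ → ℝ} (hf : IsFloydFunction f)
    {color : ι → κ} {color' : ι' → κ} (hcolor : Function.Surjective color)
    (hcolor' : Function.Surjective color')
    (hiso : ∀ i i', color i = color' i' →
      Nonempty (FloydBoundary f (T i) ≃ₜ FloydBoundary f (T' i'))) :
    Nonempty (FloydBoundary f (factorGens of T) ≃ₜ FloydBoundary f (factorGens of' T')) := by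
  have := countable_of_closure (h.closure_factorGens hT) (finite_iUnion fun i => (hfin i).image _)
  have := countable_of_closure (h'.closure_factorGens hT')
    (finite_iUnion fun i => (hfin' i).image _)
  have := fun i => compactSpace_completion hf (hT i) (hfin i)
  have := fun i => compactSpace_completion hf (hT' i) (hfin' i)
  have := fun i => metrizableSpace_completion f (hT i)
  have := fun i => metrizableSpace_completion f (hT' i)
  have := compactSpace_boundary hf (h.closure_factorGens hT)
    (finite_iUnion fun i => (hfin i).image _)
  have := compactSpace_boundary hf (h'.closure_factorGens hT')
    (finite_iUnion fun i => (hfin' i).image _)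
  obtain ⟨i₀⟩ : Nonempty ι := inferInstance
  obtain ⟨i₀'⟩ : Nonempty ι' := inferInstance
  have : Infinite G := Infinite.of_injective _ (h.injective_of i₀)
  have : Infinite G' := Infinite.of_injective _ (h'.injective_of i₀')
  have : Nonempty (FloydBoundary f (factorGens of T)) := (nonempty_boundary hf
    (h.closure_factorGens hT) (finite_iUnion fun i => (hfin i).image _)).to_subtype
  have : Nonempty (FloydBoundary f (factorGens of' T')) := (nonempty_boundary hf
    (h'.closure_factorGens hT') (finite_iUnion fun i => (hfin' i).image _)).to_subtype
  exact (h.gateSystem hT hf hfin hcolor).nonempty_homeomorph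
    (h'.gateSystem hT' hf hfin' hcolor') fun j j' hj => hiso _ _ hj

end Floyd

namespace Floyd

universe u v w x

open Set Monoid
open scoped NNReal

/-! ### Independence of the generating set under doubling. -/

section changeOfGenerators

variable {G : Type*} [Group G] {S S' : Set G}

theorem wordLength_inv (hS : Subgroup.closure S = ⊤) (g : G) :
    wordLength S g⁻¹ = wordLength S g := by
  have key : ∀ g, wordLength S g⁻¹ ≤ wordLength S g := fun g => by
    have := wordLength_le_add_mul hS g g⁻¹
    rwa [mul_inv_cancel, wordLength_one, add_zero] at this
  exact le_antisymm (key g) (by simpa using key g⁻¹)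

theorem exists_wordLength_le_of_adj (hS : Subgroup.closure S = ⊤) (hfin' : S'.Finite) :
    ∃ L, ∀ v w, (SimpleGraph.mulCayley S').Adj v w → wordLength S (v⁻¹ * w) ≤ L := by
  obtain ⟨L, hL⟩ := (hfin'.image (wordLength S)).bddAbove
  refine ⟨L, fun v w hadj => ?_⟩
  rcases ((SimpleGraph.mulCayley_adj _ _ _).1 hadj).2 with hs | hs
  · exact hL ⟨_, hs, rfl⟩
  · rw [← wordLength_inv hS, mul_inv_rev, inv_inv]
    exact hL ⟨_, hs, rfl⟩

theorem exists_wordLength_le (hS : Subgroup.closure S = ⊤) (hS' : Subgroup.closure S' = ⊤)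
    (hfin' : S'.Finite) : ∃ L, ∀ g, wordLength S g ≤ L * wordLength S' g := by
  obtain ⟨L, hL⟩ := exists_wordLength_le_of_adj hS hfin'
  have key : ∀ n g, wordLength S' g ≤ n → wordLength S g ≤ L * n := by
    intro n
    induction n with
    | zero =>
      intro g hg
      obtain rfl : 1 = g := (connected_mulCayley hS').dist_eq_zero_iff.1 (Nat.le_zero.1 hg)
      simp [wordLength_one]
    | succ n ih =>
      intro g hg
      rcases hg.lt_or_eq with hlt | heq
      · exact (ih g (by lia)).trans (Nat.mul_le_mul_left _ (by lia))
      · obtain ⟨g', hadj, hg'⟩ := exists_pred hS' heq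
        have h1 := wordLength_mul_le hS g' (g'⁻¹ * g)
        rw [mul_inv_cancel_left] at h1
        have h2 := ih g' hg'
        have h3 := hL _ _ hadj
        rw [mul_add, mul_one]
        lia
  exact ⟨L, fun g => key _ g le_rfl⟩

variable {f : ℕ → ℝ}

/-- A geodesic from `v` to `w` has at most `K` edges, and its vertices have length at least
`wordLength S v - K`. -/
theorem floydEDist_le_mul (hf : IsFloydFunction f) (hS : Subgroup.closure S = ⊤) {K : ℕ}
    {v w : G} (hK : wordLength S (v⁻¹ * w) ≤ K) :
    floydEDist f S v w ≤ ENNReal.ofReal (K * f (wordLength S v - K)) := by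
  classical
  obtain ⟨p, hp⟩ := (connected_mulCayley hS).exists_walk_length_eq_dist v w
  have hlen : p.length ≤ K := by
    rw [hp, ← dist_mul_left hS v⁻¹, inv_mul_cancel]
    exact hK
  refine (floydEDist_le v w p).trans (ENNReal.ofReal_le_ofReal ?_)
  have hvert : ∀ u ∈ p.support, wordLength S v ≤ wordLength S u + K := fun u hu => by
    have h1 := SimpleGraph.dist_le (p.takeUntil u hu)
    have h2 := p.length_takeUntil_le_length hu
    have h3 : wordLength S v ≤ wordLength S u + (SimpleGraph.mulCayley S).dist u v :=
      (connected_mulCayley hS).dist_triangle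
    rw [SimpleGraph.dist_comm] at h3
    lia
  refine (List.sum_le_card_nsmul _ (f (wordLength S v - K)) fun x hx => ?_).trans ?_
  · obtain ⟨e, he, rfl⟩ := List.mem_map.1 hx
    have h1 := hvert _ (p.dart_fst_mem_support_of_mem_darts he)
    have h2 := hvert _ (p.dart_snd_mem_support_of_mem_darts he)
    exact hf.antitone (by lia)
  · rw [List.length_map, SimpleGraph.Walk.length_darts, nsmul_eq_mul]
    gcongr
    exact (hf.pos' _).le

theorem exists_dilation (hf : IsFloydFunction f)
    (hD : ∃ D : ℝ, ∀ n : ℕ, 1 ≤ n → f n ≤ D * f (2 * n)) (L : ℕ) :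
    ∃ C : ℝ≥0, ∀ n, f n ≤ C * f (L * n) := by
  obtain ⟨D, hD⟩ := hD
  -- The maximum with `1` covers `n = 0`, where doubling is not assumed.
  have hstep : ∀ n, f n ≤ (max D 1) * f (2 * n) := fun n => by
    rcases Nat.eq_zero_or_pos n with rfl | hn
    · rw [mul_zero]
      exact le_mul_of_one_le_left (hf.pos' _).le (le_max_right _ _)
    · exact (hD n hn).trans (by gcongr; exacts [(hf.pos' _).le, le_max_left _ _])
  have hmax : 0 ≤ max D 1 := zero_le_one.trans (le_max_right _ _)
  have hpow : ∀ k n, f n ≤ (max D 1) ^ k * f (2 ^ k * n) := fun k => by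
    induction k with
    | zero => simp
    | succ k ih =>
      intro n
      refine (ih n).trans ?_
      rw [pow_succ (max D 1), mul_assoc]
      gcongr
      rw [pow_succ', mul_assoc]
      exact hstep _
  refine ⟨⟨(max D 1) ^ L, by positivity⟩, fun n => (hpow L n).trans ?_⟩
  refine mul_le_mul_of_nonneg_left (hf.antitone ?_) (by positivity)
  exact Nat.mul_le_mul_right _ Nat.lt_two_pow_self.le

theorem exists_change_lipschitz (hf : IsFloydFunction f)
    (hD : ∃ D : ℝ, ∀ n : ℕ, 1 ≤ n → f n ≤ D * f (2 * n)) (hS : Subgroup.closure S = ⊤)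
    (hS' : Subgroup.closure S' = ⊤) (hfin : S.Finite) (hfin' : S'.Finite) :
    ∃ C : ℝ≥0, ∀ v w, floydEDist f S' v w ≤ C * floydEDist f S v w := by
  obtain ⟨K, hK⟩ := exists_wordLength_le_of_adj hS' hfin
  obtain ⟨L, hL⟩ := exists_wordLength_le hS hS' hfin'
  obtain ⟨C₁, -, hC₁⟩ := hf.exists_shift K
  obtain ⟨C₂, hC₂⟩ := exists_dilation hf hD L
  -- `K` counts the replacing edges, `C₁` pays for the shift by `K` and `C₂` for the distortion `L`
  -- of word lengths; the `1` keeps the constant nonzero.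
  refine ⟨K * (C₁ * C₂) + 1, floydEDist_map_le hf (by positivity) id fun v w hadj => ?_⟩
  refine (floydEDist_le_mul hf hS' (hK v w hadj)).trans ?_
  rw [← ENNReal.ofReal_coe_nnreal, ← ENNReal.ofReal_mul (NNReal.coe_nonneg _)]
  refine ENNReal.ofReal_le_ofReal ?_
  set m := f (min (wordLength S v) (wordLength S w))
  have h1 : f (wordLength S' v - K) ≤ C₁ * (C₂ * m) := by
    refine (hC₁ (wordLength S' v) _ (by lia)).trans ?_
    gcongr
    refine (hC₂ _).trans ?_
    gcongr
    exact hf.antitone ((min_le_left _ _).trans (hL v))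
  have h2 : 0 ≤ m := (hf.pos' _).le
  calc (K : ℝ) * f (wordLength S' v - K) ≤ K * (C₁ * (C₂ * m)) := by gcongr
    _ ≤ ((K * (C₁ * C₂) + 1 : ℝ≥0) : ℝ) * m := by push_cast; linarith

/-- Under the doubling condition the Floyd boundary does not depend on the generating set. -/
theorem nonempty_boundary_homeomorph_of_doubling (hf : IsFloydFunction f)
    (hD : ∃ D : ℝ, ∀ n : ℕ, 1 ≤ n → f n ≤ D * f (2 * n)) (hS : Subgroup.closure S = ⊤)
    (hS' : Subgroup.closure S' = ⊤) (hfin : S.Finite) (hfin' : S'.Finite) :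
    Nonempty (FloydBoundary f S ≃ₜ FloydBoundary f S') := by
  obtain ⟨C, hC⟩ := exists_change_lipschitz hf hD hS hS' hfin hfin'
  obtain ⟨C', hC'⟩ := exists_change_lipschitz hf hD hS' hS hfin' hfin
  exact nonempty_boundary_homeomorph_of_le (Equiv.refl G) hC hC'

end changeOfGenerators

/-! ### Transport along group isomorphisms. -/

section transport

theorem closure_image_mulEquiv {G G' : Type*} [Group G] [Group G'] (e : G ≃* G') {S : Set G}
    (hS : Subgroup.closure S = ⊤) : Subgroup.closure (e '' S) = ⊤ := by
  rw [show e '' S = (e : G →* G') '' S from rfl, ← MonoidHom.map_closure, hS,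
    ← MonoidHom.range_eq_map, MonoidHom.range_eq_top]
  exact e.surjective

theorem adj_mulEquiv {G G' : Type*} [Group G] [Group G'] (e : G ≃* G') {S : Set G} {v w : G} :
    (SimpleGraph.mulCayley (e '' S)).Adj (e v) (e w) ↔ (SimpleGraph.mulCayley S).Adj v w := by
  simp only [SimpleGraph.mulCayley_adj, ← map_inv, ← map_mul, e.injective.mem_set_image,
    e.injective.ne_iff]

theorem wordLength_mulEquiv_le {G G' : Type*} [Group G] [Group G'] (e : G ≃* G') {S : Set G}
    (hS : Subgroup.closure S = ⊤) (g : G) : wordLength (e '' S) (e g) ≤ wordLength S g := by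
  obtain ⟨p, hp⟩ := (connected_mulCayley hS).exists_walk_length_eq_dist 1 g
  let φ : SimpleGraph.mulCayley S →g SimpleGraph.mulCayley (e '' S) :=
    ⟨e, fun h => (adj_mulEquiv e).2 h⟩
  have := SimpleGraph.dist_le (p.map φ)
  rw [SimpleGraph.Walk.length_map, hp] at this
  simpa [wordLength, φ] using this

theorem floydEDist_mulEquiv_le {G G' : Type*} [Group G] [Group G'] (e : G ≃* G') {S : Set G}
    (hS : Subgroup.closure S = ⊤) {f : ℕ → ℝ} (hf : IsFloydFunction f) (v w : G) :
    floydEDist f (e '' S) (e v) (e w) ≤ (1 : ℝ≥0) * floydEDist f S v w := by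
  refine floydEDist_map_le hf one_ne_zero e (fun v w hadj => ?_) v w
  have hlen : ∀ g, wordLength S g ≤ wordLength (e '' S) (e g) := fun g => by
    have := wordLength_mulEquiv_le e.symm (closure_image_mulEquiv e hS) (e g)
    rw [← image_comp] at this
    simpa using this
  refine (floydEDist_le_of_adj ((adj_mulEquiv e).2 hadj)).trans ?_
  rw [ENNReal.coe_one, one_mul]
  exact ENNReal.ofReal_le_ofReal (hf.antitone (min_le_min (hlen v) (hlen w)))

theorem nonempty_boundary_homeomorph_mulEquiv {G G' : Type*} [Group G] [Group G'] (e : G ≃* G')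
    {S : Set G} (hS : Subgroup.closure S = ⊤) {f : ℕ → ℝ} (hf : IsFloydFunction f) :
    Nonempty (FloydBoundary f S ≃ₜ FloydBoundary f (e '' S)) := by
  refine nonempty_boundary_homeomorph_of_le (C' := 1) e.toEquiv (floydEDist_mulEquiv_le e hS hf)
    fun v w => ?_
  have := floydEDist_mulEquiv_le e.symm (closure_image_mulEquiv e hS) hf v w
  rw [← image_comp] at this
  simpa using this

end transport

/-! ### Free products of two and three groups as indexed families. -/

section families

/-- The family of two groups. -/
abbrev pairFamily (A B : Type u) : Bool → Type u
  | true => A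
  | false => B

instance pairGroup (A B : Type u) [Group A] [Group B] : ∀ i, Group (pairFamily A B i)
  | true => inferInstanceAs (Group A)
  | false => inferInstanceAs (Group B)

/-- Two homomorphisms as a family. -/
def pairHom {A B : Type u} {G : Type*} [Group A] [Group B] [Group G] (α : A →* G) (β : B →* G) :
    ∀ i, pairFamily A B i →* G
  | true => α
  | false => β

/-- Two subsets as a family. -/
def pairSet {A B : Type u} (S : Set A) (T : Set B) : ∀ i, Set (pairFamily A B i)
  | true => S
  | false => T

/-- The family of three groups. -/
abbrev tripleFamily (A B C : Type u) : Fin 3 → Type u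
  | 0 => A
  | 1 => B
  | 2 => C

instance tripleGroup (A B C : Type u) [Group A] [Group B] [Group C] :
    ∀ i, Group (tripleFamily A B C i)
  | 0 => inferInstanceAs (Group A)
  | 1 => inferInstanceAs (Group B)
  | 2 => inferInstanceAs (Group C)

/-- Three homomorphisms as a family. -/
def tripleHom {A B C : Type u} {G : Type*} [Group A] [Group B] [Group C] [Group G]
    (α : A →* G) (β : B →* G) (γ : C →* G) : ∀ i, tripleFamily A B C i →* G
  | 0 => α
  | 1 => β
  | 2 => γ

/-- Three subsets as a family. -/
def tripleSet {A B C : Type u} (S : Set A) (T : Set B) (U : Set C) :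
    ∀ i, Set (tripleFamily A B C i)
  | 0 => S
  | 1 => T
  | 2 => U

theorem bijective_of_inverse {G G' : Type*} [Group G] [Group G'] {φ : G →* G'} {ψ : G' →* G}
    (h : ψ.comp φ = MonoidHom.id G) (h' : φ.comp ψ = MonoidHom.id G') : Function.Bijective φ :=
  Function.bijective_iff_has_inverse.2 ⟨ψ, DFunLike.congr_fun h, DFunLike.congr_fun h'⟩

variable {A : Type u} {B : Type v} {C : Type w} [Group A] [Group B] [Group C]

/-- A homomorphism precomposed with the lowering of universes. -/
def ofULift {A : Type u} {G : Type*} [Group A] [Group G] (φ : A →* G) : ULift.{x} A →* G :=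
  φ.comp MulEquiv.ulift.toMonoidHom

/-- A homomorphism precomposed with the lifting of universes. -/
def ofDown {A : Type u} {G : Type*} [Group A] [Group G] (φ : ULift.{x} A →* G) : A →* G :=
  φ.comp MulEquiv.ulift.symm.toMonoidHom

/-- An indexed free product needs its factors in one universe, hence the `ULift`s. -/
theorem bijective_lift_pair : Function.Bijective (CoprodI.lift (pairHom
    (ofULift.{u, v} (Coprod.inl : A →* A ∗ B)) (ofULift.{v, u} (Coprod.inr : B →* A ∗ B)))) := by
  refine bijective_of_inverse (ψ := Coprod.lift
    (ofDown.{u, v} (CoprodI.of (M := pairFamily (ULift.{v} A) (ULift.{u} B)) (i := true)))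
    (ofDown.{v, u} (CoprodI.of (M := pairFamily (ULift.{v} A) (ULift.{u} B)) (i := false)))) ?_ ?_
  · refine CoprodI.ext_hom _ _ fun i => ?_
    rcases i with _ | _ <;>
    · ext x
      simp [pairHom, ofULift, ofDown]
  · ext x <;> simp [pairHom, ofULift, ofDown]

theorem bijective_lift_triple : Function.Bijective (CoprodI.lift (tripleHom
    (ofULift.{u, max v w} ((Coprod.inl : A ∗ B →* (A ∗ B) ∗ C).comp Coprod.inl))
    (ofULift.{v, max u w} ((Coprod.inl : A ∗ B →* (A ∗ B) ∗ C).comp Coprod.inr))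
    (ofULift.{w, max u v} (Coprod.inr : C →* (A ∗ B) ∗ C)))) := by
  let M := tripleFamily (ULift.{max v w} A) (ULift.{max u w} B) (ULift.{max u v} C)
  refine bijective_of_inverse (ψ := Coprod.lift (Coprod.lift
    (ofDown.{u, max v w} (CoprodI.of (M := M) (i := 0)))
    (ofDown.{v, max u w} (CoprodI.of (M := M) (i := 1))))
    (ofDown.{w, max u v} (CoprodI.of (M := M) (i := 2)))) ?_ ?_
  · refine CoprodI.ext_hom _ _ fun i => ?_
    fin_cases i <;>
    · ext x
      simp [tripleHom, ofULift, ofDown]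
  · ext x <;> simp [tripleHom, ofULift, ofDown]

/-- A subset lifted to a higher universe. -/
def uliftSet {A : Type u} [Group A] (S : Set A) : Set (ULift.{x} A) :=
  (MulEquiv.ulift : ULift.{x} A ≃* A).symm '' S

theorem ofULift_image {A : Type u} {G : Type*} [Group A] [Group G] (φ : A →* G) (S : Set A) :
    ofULift.{u, x} φ '' uliftSet S = φ '' S := by
  rw [uliftSet, ← image_comp]
  rfl

theorem factorGens_pair (SA : Set A) (SB : Set B) : factorGens
    (pairHom (ofULift.{u, v} (Coprod.inl : A →* A ∗ B)) (ofULift.{v, u} (Coprod.inr : B →* A ∗ B)))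
    (pairSet (uliftSet SA) (uliftSet SB)) = unionGens SA SB := by
  rw [unionGens, ← ofULift_image.{u, v}, ← ofULift_image.{v, u} (Coprod.inr : B →* A ∗ B)]
  ext g
  simp only [factorGens, mem_iUnion, Bool.exists_bool, mem_union]
  exact or_comm

theorem factorGens_triple (SA : Set A) (SB : Set B) (SC : Set C) : factorGens (tripleHom
    (ofULift.{u, max v w} ((Coprod.inl : A ∗ B →* (A ∗ B) ∗ C).comp Coprod.inl))
    (ofULift.{v, max u w} ((Coprod.inl : A ∗ B →* (A ∗ B) ∗ C).comp Coprod.inr))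
    (ofULift.{w, max u v} (Coprod.inr : C →* (A ∗ B) ∗ C)))
    (tripleSet (uliftSet SA) (uliftSet SB) (uliftSet SC)) =
      unionGens (unionGens SA SB) SC := by
  have h1 := ofULift_image.{u, max v w}
    ((Coprod.inl : A ∗ B →* (A ∗ B) ∗ C).comp Coprod.inl) SA
  have h2 := ofULift_image.{v, max u w}
    ((Coprod.inl : A ∗ B →* (A ∗ B) ∗ C).comp Coprod.inr) SB
  have h3 := ofULift_image.{w, max u v} (Coprod.inr : C →* (A ∗ B) ∗ C) SC
  rw [unionGens, unionGens, image_union, ← image_comp, ← image_comp, ← MonoidHom.coe_comp,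
    ← MonoidHom.coe_comp, ← h1, ← h2, ← h3]
  ext g
  simp [factorGens, tripleHom, tripleSet, Fin.exists_fin_succ, or_assoc]

theorem closure_uliftSet {A : Type u} [Group A] {S : Set A} (hS : Subgroup.closure S = ⊤) :
    Subgroup.closure (uliftSet.{u, x} S) = ⊤ := closure_image_mulEquiv _ hS

theorem nonempty_boundary_homeomorph_uliftSet {A : Type u} [Group A] {S : Set A}
    (hS : Subgroup.closure S = ⊤) {f : ℕ → ℝ} (hf : IsFloydFunction f) :
    Nonempty (FloydBoundary f S ≃ₜ FloydBoundary f (uliftSet.{u, x} S)) :=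
  nonempty_boundary_homeomorph_mulEquiv _ hS hf

/-- The colours of the factors of `A ∗ B ∗ C`, where `A` and `C` have the same colour. -/
def tripleColor : Fin 3 → Bool
  | 0 => true
  | 1 => false
  | 2 => true

end families


theorem finite_uliftSet {A : Type u} [Group A] {S : Set A} (hS : S.Finite) :
    (uliftSet.{u, x} S).Finite := hS.image _

theorem closure_eq_top_unionGens {A : Type*} {B : Type*} [Group A] [Group B] {SA : Set A}
    {SB : Set B} (hSA : Subgroup.closure SA = ⊤) (hSB : Subgroup.closure SB = ⊤) :
    Subgroup.closure (unionGens SA SB) = ⊤ := by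
  rw [unionGens, Subgroup.closure_union, ← MonoidHom.map_closure, ← MonoidHom.map_closure, hSA,
    hSB, ← MonoidHom.range_eq_map, ← MonoidHom.range_eq_map]
  exact Monoid.Coprod.range_inl_sup_range_inr

theorem finite_unionGens {A : Type*} {B : Type*} [Group A] [Group B] {SA : Set A} {SB : Set B}
    (hSA : SA.Finite) (hSB : SB.Finite) : (unionGens SA SB).Finite :=
  (hSA.image _).union (hSB.image _)

/-- The Floyd boundaries of `A ∗ B ∗ C` and `A ∗ B` for the standard generators. -/
theorem nonempty_boundary_homeomorph_unionGens {A : Type u} {B : Type v} {C : Type w} [Group A]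
    [Group B] [Group C] [Infinite A] [Infinite B] [Infinite C] {f : ℕ → ℝ}
    (hf : IsFloydFunction f) {SA : Set A} (hSA : SA.Finite) (hSA' : Subgroup.closure SA = ⊤)
    {SB : Set B} (hSB : SB.Finite) (hSB' : Subgroup.closure SB = ⊤)
    {SC : Set C} (hSC : SC.Finite) (hSC' : Subgroup.closure SC = ⊤)
    (hAC : Nonempty (FloydBoundary f SA ≃ₜ FloydBoundary f SC)) :
    Nonempty (FloydBoundary f (unionGens (unionGens SA SB) SC) ≃ₜ
      FloydBoundary f (unionGens SA SB)) := by
  obtain ⟨π, hπ⟩ := exists_freeProjections (bijective_lift_triple (A := A) (B := B) (C := C))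
  obtain ⟨π', hπ'⟩ := exists_freeProjections (bijective_lift_pair (A := A) (B := B))
  rw [← factorGens_triple, ← factorGens_pair]
  obtain ⟨φ⟩ := hAC
  obtain ⟨a⟩ := nonempty_boundary_homeomorph_uliftSet.{u, max v w} hSA' hf
  obtain ⟨a'⟩ := nonempty_boundary_homeomorph_uliftSet.{u, v} hSA' hf
  obtain ⟨b⟩ := nonempty_boundary_homeomorph_uliftSet.{v, max u w} hSB' hf
  obtain ⟨b'⟩ := nonempty_boundary_homeomorph_uliftSet.{v, u} hSB' hf
  obtain ⟨c⟩ := nonempty_boundary_homeomorph_uliftSet.{w, max u v} hSC' hf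
  have : ∀ i, Infinite (tripleFamily (ULift.{max v w} A) (ULift.{max u w} B)
      (ULift.{max u v} C) i)
    | 0 => inferInstanceAs (Infinite (ULift A))
    | 1 => inferInstanceAs (Infinite (ULift B))
    | 2 => inferInstanceAs (Infinite (ULift C))
  have : ∀ i, Infinite (pairFamily (ULift.{v} A) (ULift.{u} B) i)
    | true => inferInstanceAs (Infinite (ULift A))
    | false => inferInstanceAs (Infinite (ULift B))
  refine nonempty_boundary_homeomorph_of_freeProjections (color := tripleColor) (color' := id)
    hπ hπ' ?_ ?_ ?_ ?_ hf ?_ Function.surjective_id ?_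
  · exact fun
      | 0 => closure_uliftSet hSA'
      | 1 => closure_uliftSet hSB'
      | 2 => closure_uliftSet hSC'
  · exact fun
      | true => closure_uliftSet hSA'
      | false => closure_uliftSet hSB'
  · exact fun
      | 0 => finite_uliftSet hSA
      | 1 => finite_uliftSet hSB
      | 2 => finite_uliftSet hSC
  · exact fun
      | true => finite_uliftSet hSA
      | false => finite_uliftSet hSB
  · exact fun
      | true => ⟨0, rfl⟩
      | false => ⟨1, rfl⟩
  -- Only pairs of equal colour remain; the one given by `C` and `A` is the place where `hAC`
  -- enters.
  · exact fun
      | 0, true, _ => ⟨a.symm.trans a'⟩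
      | 1, false, _ => ⟨b.symm.trans b'⟩
      | 2, true, _ => ⟨c.symm.trans (φ.symm.trans a')⟩

end Floyd

theorem theorem6p3 {A B C : Type*} [Group A] [Group B] [Group C]
    [Infinite A] [Infinite B] [Infinite C]
    (f : ℕ → ℝ) (hf : Floyd.IsFloydFunction f)
    (SA : Set A) (hSA : SA.Finite) (hSA' : Subgroup.closure SA = ⊤)
    (SB : Set B) (hSB : SB.Finite) (hSB' : Subgroup.closure SB = ⊤)
    (SC : Set C) (hSC : SC.Finite) (hSC' : Subgroup.closure SC = ⊤)
    (hAC : Nonempty (Floyd.FloydBoundary f SA ≃ₜ Floyd.FloydBoundary f SC)) :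
    Nonempty (Floyd.FloydBoundary f (Floyd.unionGens (Floyd.unionGens SA SB) SC) ≃ₜ
        Floyd.FloydBoundary f (Floyd.unionGens SA SB)) ∧
      ((∃ D : ℝ, ∀ n : ℕ, 1 ≤ n → f n ≤ D * f (2 * n)) →
        ∀ S : Set ((A ∗ B) ∗ C), S.Finite → Subgroup.closure S = ⊤ →
          ∀ S' : Set (A ∗ B), S'.Finite → Subgroup.closure S' = ⊤ →
            Nonempty (Floyd.FloydBoundary f S ≃ₜ Floyd.FloydBoundary f S')) := by
  obtain ⟨φ⟩ := Floyd.nonempty_boundary_homeomorph_unionGens hf hSA hSA' hSB hSB' hSC hSC' hAC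
  refine ⟨⟨φ⟩, fun hD S hS hS' T hT hT' => ?_⟩
  have hAB := Floyd.closure_eq_top_unionGens hSA' hSB'
  have hABfin := Floyd.finite_unionGens hSA hSB
  obtain ⟨ψ⟩ := Floyd.nonempty_boundary_homeomorph_of_doubling hf hD hS'
    (Floyd.closure_eq_top_unionGens hAB hSC') hS (Floyd.finite_unionGens hABfin hSC)
  obtain ⟨χ⟩ := Floyd.nonempty_boundary_homeomorph_of_doubling hf hD hAB hT' hABfin hT
  exact ⟨ψ.trans (φ.trans χ)⟩
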